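/- Let $(A_1,A_2),(B_1,B_2)\in \mathrm{GL}_2(\mathbb{R})^2$ be given by \[A_1=\begin{pmatrix}2&0\\0&1\end{pmatrix},\quad A_2=\begin{pmatrix}0&1\\1&0\end{pmatrix},\quad B_1=\begin{pmatrix}0&1\\1&0\end{pmatrix},\quad B_2=\begin{pmatrix}1&0\\0&2\end{pmatrix}.\] Each of these pairs is irreducible, that is, no nonzero proper linear subspace of $\mathbb{R}^2$ is preserved by both of its members. Moreover neither pair admits a cyclic splitting: for a pair $(C_1,C_2)$ this would be a direct sum decomposition $\mathbb{R}^2=\bigoplus_{j\in\mathbb{Z}/m\mathbb{Z}}U_j$ into linear subspaces, with $m\ge 2$, such that $C_iU_j=U_{j+1}$ for $i=1,2$ and all $j\in\mathbb{Z}/m\mathbb{Z}$. Let $\sigma$ be the shift on $\Sigma_2=\{1,2\}^{\mathbb{N}}$. For a finite word $\mathtt{i}=i_1\cdots i_n$ over $\{1,2\}$ write $A_{\mathtt{i}}=A_{i_1}\cdots A_{i_n}$ and $B_{\mathtt{i}}=B_{i_1}\cdots B_{i_n}$. Let $\beta_1,\beta_2>0$ be arbitrary and define a positive submultiplicative function on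 finite words by $\Phi(\mathtt{i}):=\|A_{\mathtt{i}}\|^{\beta_1}\|B_{\mathtt{i}}\|^{\beta_2}$, where $\|\cdot\|$ is the Euclidean operator norm. An equilibrium state of $\Phi$ is a $\sigma$-invariant Borel probability measure $\mu$ on $\Sigma_2$ such that \[\lim_{n\to\infty}\frac1n\log\sum_{|\mathtt{i}|=n}\Phi(\mathtt{i})=h(\mu)+\lim_{n\to\infty}\frac1n\int_{\Sigma_2}\log\Phi(x_1\cdots x_n)\,d\mu(x),\] where $h(\mu)$ is the Kolmogorov--Sinai entropy of $\mu$ with respect to $\sigma$. Then $\Phi$ has a unique equilibrium state, and this equilibrium state is not totally ergodic: there is an integer $n\ge1$ such that $\sigma^n$ is not ergodic with respect to it. -/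

import Mathlib

open MeasureTheory Filter
open scoped Topology

noncomputable section

namespace Thermo

/-! ### Entropy of a measure-preserving transformation -/

/-- Shannon entropy `H(⋁_{j<n} T^{-j} 𝒫)`, where the finite partition `𝒫` consists of the level
sets of `f : X → Fin k`. A nonempty element of the join is the set of points with a given
itinerary `w`; empty sets contribute `negMulLog 0 = 0`. -/
def joinEntropy {X : Type*} [MeasurableSpace X] (T : X → X) (μ : Measure X) {k : ℕ}
    (f : X → Fin k) (n : ℕ) : ℝ :=
  ∑ w : Fin n → Fin k, Real.negMulLog (μ.real {x | ∀ j : Fin n, f (T^[j] x) = w j})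

/-- Kolmogorov–Sinai entropy `h(μ)` of `T`: the supremum over all finite measurable partitions
`𝒫` of `lim (1/n) H(⋁_{j<n} T^{-j} 𝒫)`. -/
def entropy {X : Type*} [MeasurableSpace X] (T : X → X) (μ : Measure X) : EReal :=
  ⨆ (k : ℕ) (f : X → Fin k) (_ : Measurable f),
    limsup (fun n : ℕ => ((joinEntropy T μ f n / n : ℝ) : EReal)) atTop

/-- `μ` is totally ergodic for `T`: every iterate `T^n`, `n ≥ 1`, is ergodic. -/
def TotallyErgodic {X : Type*} [MeasurableSpace X] (T : X → X) (μ : Measure X) : Prop :=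
  ∀ n : ℕ, 1 ≤ n → Ergodic (T^[n]) μ

/-! ### The one-sided full shift, potentials and equilibrium states -/

/-- The one-sided full shift on `N` symbols; the symbols are `0, …, N - 1` and coordinates are
indexed from `0`. It carries the product σ-algebra, which is its Borel σ-algebra. -/
abbrev Sigma (N : ℕ) : Type := ℕ → Fin N

/-- The shift map. -/
def shift {N : ℕ} (x : Sigma N) : Sigma N := fun k => x (k + 1)

/-- The word `x|_n` made of the first `n` symbols of `x`. -/
def trunc {N : ℕ} (x : Sigma N) (n : ℕ) : List (Fin N) := List.ofFn fun j : Fin n => x j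

/-- `p` is the pressure of the potential `Φ`. -/
def HasPressure {N : ℕ} (Φ : List (Fin N) → ℝ) (p : ℝ) : Prop :=
  Tendsto (fun n : ℕ => Real.log (∑ w : Fin n → Fin N, Φ (List.ofFn w)) / n) atTop (𝓝 p)

/-- `l` is the ergodic average `Λ(Φ, μ)` of the potential `Φ` with respect to `μ`. -/
def HasErgodicAverage {N : ℕ} (Φ : List (Fin N) → ℝ) (μ : Measure (Sigma N)) (l : ℝ) : Prop :=
  Tendsto (fun n : ℕ => (∫ x, Real.log (Φ (trunc x n)) ∂μ) / n) atTop (𝓝 l)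

/-- `μ` is an equilibrium state of `Φ`: a shift-invariant Borel probability measure such that
`P(Φ) = h(μ) + Λ(Φ, μ)`. -/
def IsEquilibriumState {N : ℕ} (Φ : List (Fin N) → ℝ) (μ : Measure (Sigma N)) : Prop :=
  IsProbabilityMeasure μ ∧ MeasurePreserving shift μ μ ∧
    ∃ p h l : ℝ, HasPressure Φ p ∧ entropy shift μ = (h : EReal) ∧ HasErgodicAverage Φ μ l ∧
      p = h + l

/-- A positive submultiplicative potential. -/
def IsSubmultiplicativePotential {N : ℕ} (Φ : List (Fin N) → ℝ) : Prop :=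
  (∀ v, 0 < Φ v) ∧ ∀ v w, Φ (v ++ w) ≤ Φ v * Φ w

/-! ### Tuples of linear maps -/

section Tuples

variable {V : Type*} [NormedAddCommGroup V] [NormedSpace ℝ V] {N : ℕ}

/-- The product `A_{i₁} A_{i₂} ⋯ A_{iₙ}` along the word `(i₁, …, iₙ)`. -/
def wordProd (A : Fin N → V →L[ℝ] V) (w : List (Fin N)) : V →L[ℝ] V := (w.map A).prod

/-- No nonzero proper subspace is preserved by all the `A i`. -/
def Irreducible (A : Fin N → V →L[ℝ] V) : Prop :=
  ¬ ∃ U : Submodule ℝ V, U ≠ ⊥ ∧ U ≠ ⊤ ∧ ∀ i, U.map (A i : V →ₗ[ℝ] V) ≤ U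

/-- There is a splitting `V = U₀ ⊕ ⋯ ⊕ U_{m-1}`, `m ≥ 2`, with `A i (U j) = U (j + 1 mod m)` for
all `i` and `j`. -/
def HasCyclicSplitting (A : Fin N → V →L[ℝ] V) : Prop :=
  ∃ m : ℕ, 2 ≤ m ∧ ∃ U : ZMod m → Submodule ℝ V, DirectSum.IsInternal U ∧
    ∀ i j, (U j).map (A i : V →ₗ[ℝ] V) = U (j + 1)

end Tuples

/-! ### The two pairs and the potential -/

/-- The linear map of the Euclidean plane with the given matrix. -/
abbrev planeMap (M : Matrix (Fin 2) (Fin 2) ℝ) :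
    EuclideanSpace ℝ (Fin 2) →L[ℝ] EuclideanSpace ℝ (Fin 2) :=
  Matrix.toEuclideanCLM (n := Fin 2) (𝕜 := ℝ) M

/-- The pair `(A₁, A₂)`. -/
def pairA : Fin 2 → EuclideanSpace ℝ (Fin 2) →L[ℝ] EuclideanSpace ℝ (Fin 2) :=
  ![planeMap !![2, 0; 0, 1], planeMap !![0, 1; 1, 0]]

/-- The pair `(B₁, B₂)`. -/
def pairB : Fin 2 → EuclideanSpace ℝ (Fin 2) →L[ℝ] EuclideanSpace ℝ (Fin 2) :=
  ![planeMap !![0, 1; 1, 0], planeMap !![1, 0; 0, 2]]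

/-- The potential `i ↦ ‖A_i‖ ^ β₁ * ‖B_i‖ ^ β₂`, with Euclidean operator norms. -/
def pairPotential (β₁ β₂ : ℝ) (w : List (Fin 2)) : ℝ :=
  ‖wordProd pairA w‖ ^ β₁ * ‖wordProd pairB w‖ ^ β₂

end Thermo

end

noncomputable section

namespace Thermo

/-! All four matrices are monomial with nonnegative entries. Row `e` of a product $A_w$ therefore
has one nonzero entry, the product of the entries met along a deterministic path of rows, and
$\|A_w\|$ equals the larger of the two row entries up to a factor 2; likewise for $B_w$. Hence
$\Phi(w)$ is comparable with the sum of the path weights of $w$ over the four states $(e,f)$ of an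
automaton in which each symbol keeps one of $e,f$ and flips the other.

Every symbol acts as a weight-preserving involution, so the transfer matrix is symmetric. A positive
eigenvector $r$ turns the weights into transition probabilities of a Markov chain with reversible
weights $r^2$. The law `stationary` of the symbols read is a Gibbs measure of $\Phi$
(`exists_isGibbs_stationary`), and it is ergodic because the automaton is transitive
(`ergodic_stationary`).

Uniqueness is `IsGibbs.isEquilibriumState_iff`. By subadditivity an equilibrium state $\nu$
satisfies $nP\le H_n(\nu)+\int\log\Phi_n\,d\nu$ for every $n$, not only asymptotically. Gibbs'
inequality then forces $\nu\ll\mu$ for the Gibbs measure $\mu$, and ergodicity of $\mu$ gives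
$\nu=\mu$. This uses the Kolmogorov–Sinai theorem `entropy_shift_eq` to replace $h(\nu)$ by the
growth rate of block entropies.

Total ergodicity fails at $\sigma^2$ (`not_ergodic_iterate_two`). Each symbol changes the parity of
$e+f$, so $\mu$ is a sum of two $\sigma^2$-invariant measures exchanged by $\sigma$. If $\sigma^2$
were ergodic they would coincide; comparing total masses and the cylinders of words $ii$ would make
$r$ constant. But the transfer matrix has the unequal row sums $p+1$ and $p+q$, where
$p=2^{\beta_1}$ and $q=2^{\beta_2}>1$. -/

/-! ### The two pairs: invertibility, irreducibility, absence of cyclic splittings. -/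

lemma planeMap_apply (M : Matrix (Fin 2) (Fin 2) ℝ) (x : EuclideanSpace ℝ (Fin 2)) (i : Fin 2) :
    planeMap M x i = M i 0 * x 0 + M i 1 * x 1 := by
  have := congrFun (Matrix.ofLp_toEuclideanCLM (𝕜 := ℝ) M x) i
  rw [planeMap, this, Matrix.mulVec, dotProduct, Fin.sum_univ_two]

lemma isUnit_planeMap {M : Matrix (Fin 2) (Fin 2) ℝ} (hM : M.det ≠ 0) : IsUnit (planeMap M) :=
  ((Matrix.isUnit_iff_isUnit_det M).2 hM.isUnit).map
    (Matrix.toEuclideanCLM (n := Fin 2) (𝕜 := ℝ))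

lemma isUnit_pairA (i : Fin 2) : IsUnit (pairA i) := by
  fin_cases i <;> exact isUnit_planeMap (by simp [Matrix.det_fin_two])

lemma isUnit_pairB (i : Fin 2) : IsUnit (pairB i) := by
  fin_cases i <;> exact isUnit_planeMap (by simp [Matrix.det_fin_two])

/-- A nonzero subspace of the plane that is invariant under the coordinate swap `S` and under the
projection to the first axis is the whole plane. -/
lemma eq_top_of_swap {U : Submodule ℝ (EuclideanSpace ℝ (Fin 2))}
    {S : EuclideanSpace ℝ (Fin 2) →L[ℝ] EuclideanSpace ℝ (Fin 2)}
    (hS : S = planeMap !![0, 1; 1, 0]) (hU : ∀ x ∈ U, S x ∈ U) (hb : U ≠ ⊥)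
    (hc : ∀ x ∈ U, (!₂[x 0, 0] : EuclideanSpace ℝ (Fin 2)) ∈ U) : U = ⊤ := by
  subst hS
  obtain ⟨x, hx, hx0⟩ := U.ne_bot_iff.1 hb
  have key : ∀ a : ℝ, a ≠ 0 → (!₂[a, 0] : EuclideanSpace ℝ (Fin 2)) ∈ U → U = ⊤ := by
    intro a ha h
    refine eq_top_iff.2 fun y _ => ?_
    have h2 := hU _ h
    have : y = (y 0 / a) • (!₂[a, 0] : EuclideanSpace ℝ (Fin 2)) +
        (y 1 / a) • planeMap !![0, 1; 1, 0] !₂[a, 0] := by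
      ext i
      fin_cases i <;> simp [ha]
    rw [this]
    exact U.add_mem (U.smul_mem _ h) (U.smul_mem _ h2)
  by_cases h0 : x 0 = 0
  · have h1 : x 1 ≠ 0 := fun h1 => hx0 (by ext i; fin_cases i <;> simp [h0, h1])
    refine key (x 1) h1 ?_
    have := hc _ (hU x hx)
    simpa [planeMap_apply] using this
  · exact key _ h0 (hc x hx)

lemma irreducible_pairA : Irreducible pairA := by
  rintro ⟨U, hb, ht, h⟩
  refine ht (eq_top_of_swap (S := pairA 1) rfl (fun x hx => h 1 ⟨x, hx, rfl⟩) hb fun x hx => ?_)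
  -- The projection to the first axis is $A_1-I$.
  have := U.sub_mem (h 0 ⟨x, hx, rfl⟩) hx
  convert this using 1
  ext i
  fin_cases i <;> simp [pairA, planeMap_apply]
  ring

lemma irreducible_pairB : Irreducible pairB := by
  rintro ⟨U, hb, ht, h⟩
  refine ht (eq_top_of_swap (S := pairB 0) rfl (fun x hx => h 0 ⟨x, hx, rfl⟩) hb fun x hx => ?_)
  -- The projection to the first axis is $2I-B_2$.
  have := U.sub_mem (U.smul_mem (2 : ℝ) hx) (h 1 ⟨x, hx, rfl⟩)
  convert this using 1
  ext i
  fin_cases i <;> simp [pairB, planeMap_apply]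
  ring

/-- A pair consisting, in either order, of the coordinate swap and a diagonal map with entries
`a ^ 2 ≠ d ^ 2` has no cyclic splitting. -/
lemma not_hasCyclicSplitting {A : Fin 2 → EuclideanSpace ℝ (Fin 2) →L[ℝ] EuclideanSpace ℝ (Fin 2)}
    (i k : Fin 2) {a d : ℝ} (hD : A i = planeMap !![a, 0; 0, d])
    (hS : A k = planeMap !![0, 1; 1, 0]) (ha : a ≠ 0) (hd : d ≠ 0) (had : a ^ 2 - d ^ 2 ≠ 0) :
    ¬ HasCyclicSplitting A := by
  rintro ⟨m, hm, U, hU, h⟩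
  have : Fact (1 < m) := ⟨hm⟩
  have hmap : ∀ i j x, x ∈ U j → A i x ∈ U (j + 1) := fun i j x hx => by
    rw [← h i j]; exact ⟨x, hx, rfl⟩
  obtain ⟨j, hj⟩ : ∃ j, U j ≠ ⊥ := by
    by_contra! hbot
    have := hU.submodule_iSup_eq_top
    rw [show U = fun _ => ⊥ from funext hbot, iSup_const] at this
    exact bot_ne_top this
  obtain ⟨x, hx, hx0⟩ := (U j).ne_bot_iff.1 hj
  -- With $S$ the swap and $D$ the diagonal map, both $S^2x=x$ and $D^2x$ lie in $U_{j+2}$.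
  have h1 := hmap k _ _ (hmap k _ _ hx)
  have h2 := hmap i _ _ (hmap i _ _ hx)
  rw [hS] at h1
  rw [hD] at h2
  have hxS : planeMap !![0, 1; 1, 0] (planeMap !![0, 1; 1, 0] x) = x := by
    ext i; fin_cases i <;> simp [planeMap_apply]
  rw [hxS] at h1
  have hdis : Disjoint (U (j + 1 + 1)) (U (j + 1 + 1 + 1)) :=
    hU.submodule_iSupIndep.pairwiseDisjoint (by simp)
  rw [Submodule.disjoint_def] at hdis
  have eig : ∀ (y : EuclideanSpace ℝ (Fin 2)) (c : ℝ), c ≠ 0 → y ∈ U (j + 1 + 1) →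
      planeMap !![a, 0; 0, d] y = c • y → y = 0 := by
    intro y c hc hy hyc
    refine hdis y hy ?_
    have := hmap i _ _ hy
    rw [hD, hyc] at this
    simpa [smul_smul, hc] using (U (j + 1 + 1 + 1)).smul_mem c⁻¹ this
  -- The vectors $(D^2-d^2)x$ and $(a^2-D^2)x$ lie on the axes, so they are eigenvectors of $D$ or
  -- zero. An eigenvector in $U_{j+2}$ would also lie in $U_{j+3}$, so both vanish.
  have e0 := eig _ a ha ((U (j + 1 + 1)).sub_mem h2 ((U (j + 1 + 1)).smul_mem (d ^ 2) h1))
    (by ext i; fin_cases i <;> simp [planeMap_apply] <;> ring)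
  have e1 := eig _ d hd ((U (j + 1 + 1)).sub_mem ((U (j + 1 + 1)).smul_mem (a ^ 2) h1) h2)
    (by ext i; fin_cases i <;> simp [planeMap_apply] <;> ring)
  have c0 := congrArg (fun y : EuclideanSpace ℝ (Fin 2) => y 0) e0
  have c1 := congrArg (fun y : EuclideanSpace ℝ (Fin 2) => y 1) e1
  simp [planeMap_apply] at c0 c1
  have c0' : (a ^ 2 - d ^ 2) * x 0 = 0 := by linear_combination c0
  have c1' : (a ^ 2 - d ^ 2) * x 1 = 0 := by linear_combination c1
  refine hx0 ?_
  ext i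
  fin_cases i
  · simpa [had] using c0'
  · simpa [had] using c1'

lemma not_hasCyclicSplitting_pairA : ¬ HasCyclicSplitting pairA :=
  not_hasCyclicSplitting 0 1 (a := 2) (d := 1) rfl rfl (by norm_num) (by norm_num) (by norm_num)

lemma not_hasCyclicSplitting_pairB : ¬ HasCyclicSplitting pairB :=
  not_hasCyclicSplitting 1 0 (a := 1) (d := 2) rfl rfl (by norm_num) (by norm_num) (by norm_num)

lemma wordProd_cons {V : Type*} [NormedAddCommGroup V] [NormedSpace ℝ V] {N : ℕ}
    (A : Fin N → V →L[ℝ] V) (i : Fin N) (w : List (Fin N)) :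
    wordProd A (i :: w) = A i * wordProd A w := by simp [wordProd]

lemma norm_wordProd_append_le {V : Type*} [NormedAddCommGroup V] [NormedSpace ℝ V] {N : ℕ}
    (A : Fin N → V →L[ℝ] V) (v w : List (Fin N)) :
    ‖wordProd A (v ++ w)‖ ≤ ‖wordProd A v‖ * ‖wordProd A w‖ := by
  simpa [wordProd] using norm_mul_le (wordProd A v) (wordProd A w)

lemma norm_wordProd_pos {V : Type*} [NormedAddCommGroup V] [NormedSpace ℝ V] [Nontrivial V] {N : ℕ}
    {A : Fin N → V →L[ℝ] V} (hA : ∀ i, IsUnit (A i)) (w : List (Fin N)) :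
    0 < ‖wordProd A w‖ := by
  have : IsUnit (wordProd A w) := by
    induction w with
    | nil => simp [wordProd]
    | cons i w ih => rw [wordProd_cons]; exact (hA i).mul ih
  exact norm_pos_iff.2 this.ne_zero

lemma pairPotential_pos (β₁ β₂ : ℝ) (w : List (Fin 2)) : 0 < pairPotential β₁ β₂ w :=
  mul_pos (Real.rpow_pos_of_pos (norm_wordProd_pos isUnit_pairA w) _)
    (Real.rpow_pos_of_pos (norm_wordProd_pos isUnit_pairB w) _)

lemma isSubmultiplicativePotential_pairPotential {β₁ β₂ : ℝ} (hβ₁ : 0 ≤ β₁) (hβ₂ : 0 ≤ β₂) :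
    IsSubmultiplicativePotential (pairPotential β₁ β₂) := by
  refine ⟨pairPotential_pos β₁ β₂, fun v w => ?_⟩
  calc pairPotential β₁ β₂ (v ++ w)
      ≤ (‖wordProd pairA v‖ * ‖wordProd pairA w‖) ^ β₁ *
        (‖wordProd pairB v‖ * ‖wordProd pairB w‖) ^ β₂ := by
        unfold pairPotential
        gcongr <;> exact norm_wordProd_append_le _ _ _
    _ = _ := by
        rw [Real.mul_rpow (norm_nonneg _) (norm_nonneg _),
          Real.mul_rpow (norm_nonneg _) (norm_nonneg _), pairPotential, pairPotential]
        ring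

/-! ### Shannon entropy of finitely valued random variables. -/

section Shannon

variable {X : Type*} [MeasurableSpace X] {α β : Type*}

/-- Shannon entropy of a random variable with finitely many values. -/
def shannon [Fintype α] (ν : Measure X) (Y : X → α) : ℝ :=
  ∑ a, Real.negMulLog (ν.real (Y ⁻¹' {a}))

lemma shannon_nonneg [Fintype α] (ν : Measure X) [IsProbabilityMeasure ν] (Y : X → α) :
    0 ≤ shannon ν Y :=
  Finset.sum_nonneg fun _ _ => Real.negMulLog_nonneg measureReal_nonneg measureReal_le_one

lemma measureReal_preimage_fst_ne_zero (ν : Measure X) [IsFiniteMeasure ν] {Y : X → α}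
    {V : X → β} {z : α × β}
    (h : ν.real ((fun x => (Y x, V x)) ⁻¹' {z}) ≠ 0) : 0 < ν.real (Y ⁻¹' {z.1}) :=
  (lt_of_le_of_ne measureReal_nonneg h.symm).trans_le
    (measureReal_mono (fun x hx => by simpa using congrArg Prod.fst hx))

lemma measureReal_preimage_snd_ne_zero (ν : Measure X) [IsFiniteMeasure ν] {Y : X → α}
    {V : X → β} {z : α × β}
    (h : ν.real ((fun x => (Y x, V x)) ⁻¹' {z}) ≠ 0) : 0 < ν.real (V ⁻¹' {z.2}) :=
  (lt_of_le_of_ne measureReal_nonneg h.symm).trans_le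
    (measureReal_mono (fun x hx => by simpa using congrArg Prod.snd hx))

/-- This is $\log t\le t-1$ at $t=q/p$. Summed over a distribution, the term `q - p` contributes at
most 0. -/
lemma negMulLog_add_mul_log_le {p q : ℝ} (hp : 0 ≤ p) (hq : 0 ≤ q) (h : p ≠ 0 → 0 < q) :
    Real.negMulLog p ≤ p * -Real.log q + (q - p) := by
  rcases eq_or_ne p 0 with rfl | h0
  · simpa using hq
  have hp' : 0 < p := lt_of_le_of_ne hp h0.symm
  have hq' := h h0
  have := Real.log_le_sub_one_of_pos (div_pos hq' hp')
  rw [Real.log_div hq'.ne' h0] at this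
  have h2 := mul_le_mul_of_nonneg_left this hp
  rw [mul_sub, mul_sub, mul_div_cancel₀ _ h0] at h2
  rw [Real.negMulLog]
  linarith

variable [Fintype α] [MeasurableSpace α] [MeasurableSingletonClass α]
  [Fintype β] [MeasurableSpace β] [MeasurableSingletonClass β]

lemma integral_comp_fintype (ν : Measure X) [IsFiniteMeasure ν] {Y : X → α} (hY : Measurable Y)
    (F : α → ℝ) : ∫ x, F (Y x) ∂ν = ∑ a, ν.real (Y ⁻¹' {a}) * F a := by
  rw [← integral_map (f := F) hY.aemeasurable (measurable_of_finite F).aestronglyMeasurable,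
    integral_fintype .of_finite]
  simp [map_measureReal_apply hY (measurableSet_singleton _)]

lemma integrable_comp_fintype (ν : Measure X) [IsFiniteMeasure ν] {Y : X → α} (hY : Measurable Y)
    (F : α → ℝ) : Integrable (fun x => F (Y x)) ν :=
  (Integrable.of_finite (μ := ν.map Y) (f := F)).comp_measurable hY

lemma sum_measureReal_preimage_singleton_eq_one (ν : Measure X) [IsProbabilityMeasure ν] {Y : X → α}
    (hY : Measurable Y) : ∑ a, ν.real (Y ⁻¹' {a}) = 1 := by
  simpa using (integral_comp_fintype ν hY (fun _ => 1)).symm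

/-- Gibbs' inequality. -/
lemma shannon_le_of_sum_le_one (ν : Measure X) [IsProbabilityMeasure ν] {Y : X → α}
    (hY : Measurable Y) (q : α → ℝ) (hq : ∀ a, 0 ≤ q a) (hsum : ∑ a, q a ≤ 1)
    (hpos : ∀ a, ν.real (Y ⁻¹' {a}) ≠ 0 → 0 < q a) :
    shannon ν Y ≤ ∑ a, ν.real (Y ⁻¹' {a}) * -Real.log (q a) := by
  calc shannon ν Y ≤ ∑ a, (ν.real (Y ⁻¹' {a}) * -Real.log (q a) + (q a - ν.real (Y ⁻¹' {a}))) :=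
        Finset.sum_le_sum fun a _ =>
          negMulLog_add_mul_log_le measureReal_nonneg (hq a) (hpos a)
    _ ≤ _ := by
        rw [Finset.sum_add_distrib, Finset.sum_sub_distrib,
          sum_measureReal_preimage_singleton_eq_one ν hY]
        linarith

lemma shannon_eq_integral (ν : Measure X) [IsProbabilityMeasure ν] {Y : X → α}
    (hY : Measurable Y) :
    shannon ν Y = ∫ x, -Real.log (ν.real (Y ⁻¹' {Y x})) ∂ν := by
  rw [integral_comp_fintype ν hY fun a => -Real.log (ν.real (Y ⁻¹' {a}))]
  simp [shannon, Real.negMulLog]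

/-- The entropy of a function of a random variable is at most the entropy of the variable. -/
lemma shannon_comp_le (ν : Measure X) [IsProbabilityMeasure ν] {Y : X → α} (hY : Measurable Y)
    (g : α → β) : shannon ν (fun x => g (Y x)) ≤ shannon ν Y := by
  have hg : Measurable g := measurable_of_finite g
  rw [shannon_eq_integral ν (Y := fun x => g (Y x)) (hg.comp hY),
    integral_comp_fintype ν hY fun a => -Real.log (ν.real ((fun x => g (Y x)) ⁻¹' {g a}))]
  refine Finset.sum_le_sum fun a _ => ?_
  rcases eq_or_ne (ν.real (Y ⁻¹' {a})) 0 with h | h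
  · simp [h]
  rw [Real.negMulLog, neg_mul, ← mul_neg]
  refine mul_le_mul_of_nonneg_left (neg_le_neg (Real.log_le_log ?_ ?_)) measureReal_nonneg
  · exact lt_of_le_of_ne measureReal_nonneg h.symm
  · exact measureReal_mono fun x hx => by simp_all

/-- Entropy of `Y` is at most the entropy of `V` plus the cost of coding `Y` given `V` by means of
a positive kernel. -/
lemma shannon_le_add_integral_log_kernel (ν : Measure X) [IsProbabilityMeasure ν] {Y : X → α}
    {V : X → β} (hY : Measurable Y) (hV : Measurable V) (κ : β → α → ℝ) (hκ : ∀ b a, 0 < κ b a)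
    (hsum : ∀ b, ∑ a, κ b a ≤ 1) :
    shannon ν (fun x => (Y x, V x)) ≤ shannon ν V + ∫ x, -Real.log (κ (V x) (Y x)) ∂ν := by
  have hZ : Measurable fun x => (Y x, V x) := hY.prodMk hV
  calc shannon ν (fun x => (Y x, V x))
      ≤ ∑ z : α × β, ν.real ((fun x => (Y x, V x)) ⁻¹' {z}) *
          -Real.log (ν.real (V ⁻¹' {z.2}) * κ z.2 z.1) := by
        refine shannon_le_of_sum_le_one ν hZ _
          (fun z => mul_nonneg measureReal_nonneg (hκ _ _).le) ?_
          (fun z hz => mul_pos (measureReal_preimage_snd_ne_zero ν hz) (hκ _ _))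
        rw [Fintype.sum_prod_type_right]
        simp only [← Finset.mul_sum]
        calc ∑ b, ν.real (V ⁻¹' {b}) * ∑ a, κ b a ≤ ∑ b, ν.real (V ⁻¹' {b}) * 1 := by
              gcongr with b; exact hsum b
          _ = 1 := by simpa using sum_measureReal_preimage_singleton_eq_one ν hV
    _ = ∑ z : α × β, ν.real ((fun x => (Y x, V x)) ⁻¹' {z}) *
          (-Real.log (ν.real (V ⁻¹' {z.2})) + -Real.log (κ z.2 z.1)) := by
        refine Finset.sum_congr rfl fun z _ => ?_
        rcases eq_or_ne (ν.real ((fun x => (Y x, V x)) ⁻¹' {z})) 0 with h | h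
        · simp [h]
        rw [Real.log_mul (measureReal_preimage_snd_ne_zero ν h).ne' (hκ _ _).ne']
        ring
    _ = _ := by
        rw [← integral_comp_fintype ν hZ fun z =>
          (-Real.log (ν.real (V ⁻¹' {z.2})) + -Real.log (κ z.2 z.1)), shannon_eq_integral ν hV]
        exact integral_add
          (integrable_comp_fintype ν hV fun b => -Real.log (ν.real (V ⁻¹' {b})))
          (integrable_comp_fintype ν hZ fun z => -Real.log (κ z.2 z.1))

lemma shannon_prodMk_le (ν : Measure X) [IsProbabilityMeasure ν] {Y : X → α} {V : X → β}
    (hY : Measurable Y) (hV : Measurable V) :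
    shannon ν (fun x => (Y x, V x)) ≤ shannon ν Y + shannon ν V := by
  have hZ : Measurable fun x => (Y x, V x) := hY.prodMk hV
  calc shannon ν (fun x => (Y x, V x))
      ≤ ∑ z : α × β, ν.real ((fun x => (Y x, V x)) ⁻¹' {z}) *
          -Real.log (ν.real (Y ⁻¹' {z.1}) * ν.real (V ⁻¹' {z.2})) := by
        refine shannon_le_of_sum_le_one ν hZ _
          (fun z => mul_nonneg measureReal_nonneg measureReal_nonneg) ?_
          (fun z hz => mul_pos (measureReal_preimage_fst_ne_zero ν hz)
            (measureReal_preimage_snd_ne_zero ν hz))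
        rw [Fintype.sum_prod_type]
        simp only [← Finset.mul_sum, sum_measureReal_preimage_singleton_eq_one ν hV, mul_one,
          sum_measureReal_preimage_singleton_eq_one ν hY, le_refl]
    _ = ∑ z : α × β, ν.real ((fun x => (Y x, V x)) ⁻¹' {z}) *
          (-Real.log (ν.real (Y ⁻¹' {z.1})) + -Real.log (ν.real (V ⁻¹' {z.2}))) := by
        refine Finset.sum_congr rfl fun z _ => ?_
        rcases eq_or_ne (ν.real ((fun x => (Y x, V x)) ⁻¹' {z})) 0 with h | h
        · simp [h]
        rw [Real.log_mul (measureReal_preimage_fst_ne_zero ν h).ne'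
          (measureReal_preimage_snd_ne_zero ν h).ne']
        ring
    _ = _ := by
        rw [← integral_comp_fintype ν hZ fun z =>
          (-Real.log (ν.real (Y ⁻¹' {z.1})) + -Real.log (ν.real (V ⁻¹' {z.2}))),
          shannon_eq_integral ν hV, shannon_eq_integral ν hY]
        exact integral_add
          (integrable_comp_fintype ν hY fun b => -Real.log (ν.real (Y ⁻¹' {b})))
          (integrable_comp_fintype ν hV fun b => -Real.log (ν.real (V ⁻¹' {b})))

lemma shannon_comp_measurePreserving {ν : Measure X} {T : X → X} (hT : MeasurePreserving T ν ν)
    {Y : X → α} (hY : Measurable Y) : shannon ν (fun x => Y (T x)) = shannon ν Y := by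
  refine Finset.sum_congr rfl fun a _ => ?_
  have := hT.measureReal_preimage (hY (measurableSet_singleton a)).nullMeasurableSet
  rw [← this]; rfl

end Shannon

/-! ### Itineraries and subadditivity of their entropies. -/

section Itinerary

variable {X : Type*} {k : ℕ}

/-- The first `n` symbols of the itinerary of `x` with respect to the partition given by `f`. -/
def itinerary (T : X → X) (f : X → Fin k) (n : ℕ) (x : X) : Fin n → Fin k := fun j => f (T^[j] x)

lemma itinerary_add (T : X → X) (f : X → Fin k) (m n : ℕ) :
    itinerary T f (m + n) = fun x =>
      Fin.append (itinerary T f m x) (itinerary T f n (T^[m] x)) := by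
  ext x j
  refine Fin.addCases (fun i => ?_) (fun i => ?_) j
  · simp [itinerary]
  · simp [itinerary, ← Function.iterate_add_apply, add_comm]

variable [MeasurableSpace X]

lemma joinEntropy_eq_shannon (T : X → X) (ν : Measure X) (f : X → Fin k) (n : ℕ) :
    joinEntropy T ν f n = shannon ν (itinerary T f n) := by
  refine Finset.sum_congr rfl fun w _ => ?_
  congr 2
  ext x
  simp [itinerary, funext_iff]

lemma measurable_itinerary {T : X → X} (hT : Measurable T) {f : X → Fin k} (hf : Measurable f)
    (n : ℕ) : Measurable (itinerary T f n) :=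
  measurable_pi_lambda _ fun j => hf.comp (hT.iterate j)

lemma joinEntropy_nonneg (T : X → X) (ν : Measure X) [IsProbabilityMeasure ν] (f : X → Fin k)
    (n : ℕ) : 0 ≤ joinEntropy T ν f n := by
  rw [joinEntropy_eq_shannon]; exact shannon_nonneg ν _

lemma subadditive_joinEntropy {T : X → X} {ν : Measure X} [IsProbabilityMeasure ν]
    (hT : MeasurePreserving T ν ν) {f : X → Fin k} (hf : Measurable f) :
    Subadditive (joinEntropy T ν f) := by
  intro m n
  have hm := measurable_itinerary hT.measurable hf m
  have hn := measurable_itinerary hT.measurable hf n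
  have hn' : Measurable fun x => itinerary T f n (T^[m] x) := hn.comp (hT.measurable.iterate m)
  rw [joinEntropy_eq_shannon, joinEntropy_eq_shannon, joinEntropy_eq_shannon,
    itinerary_add T f m n, ← shannon_comp_measurePreserving (hT.iterate m) hn]
  exact (shannon_comp_le ν (hm.prodMk hn') fun z => Fin.append z.1 z.2).trans
    (shannon_prodMk_le ν hm hn')

lemma bddBelow_joinEntropy_div (T : X → X) (ν : Measure X) [IsProbabilityMeasure ν]
    (f : X → Fin k) : BddBelow (Set.range fun n : ℕ => joinEntropy T ν f n / n) :=
  ⟨0, by rintro _ ⟨n, rfl⟩; exact div_nonneg (joinEntropy_nonneg T ν f n) n.cast_nonneg⟩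

end Itinerary

/-! ### Cylinders of the shift and the Kolmogorov–Sinai theorem. -/

section Prefix

variable {N : ℕ}

/-- The first `n` symbols of `x`, as a function on `Fin n`. -/
def prefixWord (n : ℕ) (x : Sigma N) : Fin n → Fin N := fun j => x j

lemma measurable_prefixWord (n : ℕ) : Measurable (prefixWord (N := N) n) :=
  measurable_pi_lambda _ fun _ => measurable_pi_apply _

lemma measurable_shift : Measurable (shift (N := N)) :=
  measurable_pi_lambda _ fun k => measurable_pi_apply (k + 1)

lemma iterate_shift_apply (j k : ℕ) (x : Sigma N) : shift^[j] x k = x (k + j) := by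
  induction j generalizing x with
  | zero => rfl
  | succ j ih => rw [Function.iterate_succ_apply, ih]; simp [shift, add_assoc]

lemma itinerary_shift_eq_prefixWord (n : ℕ) :
    itinerary (shift (N := N)) (fun x => x 0) n = prefixWord n := by
  ext x j
  simp [itinerary, prefixWord, iterate_shift_apply]

lemma exists_eq_preimage_prefixWord {t : Set (Sigma N)}
    (ht : t ∈ measurableCylinders fun _ : ℕ => Fin N) :
    ∃ (m : ℕ) (S : Set (Fin m → Fin N)), t = prefixWord m ⁻¹' S := by
  obtain ⟨s, S, -, rfl⟩ := (mem_measurableCylinders t).1 ht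
  exact ⟨s.sup id + 1,
    {v | (fun i : s => v ⟨i, Nat.lt_succ_of_le (Finset.le_sup (f := id) i.2)⟩) ∈ S}, rfl⟩

/-- A finite measure on the shift is determined by its values on cylinders. -/
lemma ext_of_prefixWord {μ ν : Measure (Sigma N)} [IsFiniteMeasure μ]
    (h : ∀ n (w : Fin n → Fin N), μ (prefixWord n ⁻¹' {w}) = ν (prefixWord n ⁻¹' {w})) :
    μ = ν := by
  have hmap : ∀ n (S : Set (Fin n → Fin N)), μ (prefixWord n ⁻¹' S) = ν (prefixWord n ⁻¹' S) := by
    intro n S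
    have : μ.map (prefixWord n) = ν.map (prefixWord n) := by
      refine Measure.ext_of_singleton fun w => ?_
      rw [Measure.map_apply (measurable_prefixWord n) (measurableSet_singleton w),
        Measure.map_apply (measurable_prefixWord n) (measurableSet_singleton w), h]
    have hS := (Set.toFinite S).measurableSet
    rw [← Measure.map_apply (measurable_prefixWord n) hS, this,
      Measure.map_apply (measurable_prefixWord n) hS]
  refine ext_of_generate_finite _ generateFrom_measurableCylinders.symm
    isPiSystem_measurableCylinders (fun t ht => ?_) (by simpa using hmap 0 Set.univ)
  obtain ⟨m, S, rfl⟩ := exists_eq_preimage_prefixWord ht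
  exact hmap m S

/-- Measurable sets are approximated in measure by sets depending on finitely many coordinates. -/
lemma exists_prefixWord_symmDiff_lt (ν : Measure (Sigma N)) [IsFiniteMeasure ν] {E : Set (Sigma N)}
    (hE : MeasurableSet E) {ε : ℝ} (hε : 0 < ε) :
    ∃ (m : ℕ) (S : Set (Fin m → Fin N)), ν.real (symmDiff (prefixWord m ⁻¹' S) E) < ε := by
  obtain ⟨t, ht, hlt⟩ := exists_measure_symmDiff_lt_of_generateFrom_isSetRing (μ := ν)
    (isSetRing_measurableCylinders (α := fun _ : ℕ => Fin N))
    ⟨{Set.univ}, Set.countable_singleton _,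
      Set.singleton_subset_iff.2 (univ_mem_measurableCylinders _), by simp⟩
    generateFrom_measurableCylinders.symm hE (ENNReal.ofReal_pos.2 hε)
  obtain ⟨m, S, rfl⟩ := exists_eq_preimage_prefixWord ht
  exact ⟨m, S, (ENNReal.lt_ofReal_iff_toReal_lt (measure_ne_top _ _)).1 hlt⟩

/-- Finite measurable partitions are approximated by partitions depending on finitely many
coordinates. -/
lemma exists_prefixWord_ne_lt (ν : Measure (Sigma N)) [IsFiniteMeasure ν] {k : ℕ} [NeZero k]
    {f : Sigma N → Fin k} (hf : Measurable f) {ε : ℝ} (hε : 0 < ε) :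
    ∃ (m : ℕ) (g : (Fin m → Fin N) → Fin k), ν.real {x | g (prefixWord m x) ≠ f x} < ε := by
  classical
  have hk : (0 : ℝ) < k := Nat.cast_pos.2 (NeZero.pos k)
  choose m S hS using fun j : Fin k => exists_prefixWord_symmDiff_lt ν
    (hf (measurableSet_singleton j)) (div_pos hε hk)
  set M := Finset.univ.sup m
  have hm : ∀ j, m j ≤ M := fun j => Finset.le_sup (Finset.mem_univ j)
  set S' : Fin k → Set (Fin M → Fin N) := fun j =>
    {v | (fun i : Fin (m j) => v (i.castLE (hm j))) ∈ S j}
  have hS' : ∀ j, prefixWord M ⁻¹' S' j = prefixWord (m j) ⁻¹' S j := fun j => rfl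
  -- The sets `S' j` may overlap or fail to cover. Off the union of the symmetric differences
  -- exactly one of them contains the prefix, so neither the choice nor the default 0 matters there.
  refine ⟨M, fun v => if h : ∃ j, v ∈ S' j then h.choose else 0, ?_⟩
  have hsub : {x | (fun v => if h : ∃ j, v ∈ S' j then h.choose else 0) (prefixWord M x) ≠ f x} ⊆
      ⋃ j, symmDiff (prefixWord (m j) ⁻¹' S j) (f ⁻¹' {j}) := by
    intro x hx
    by_contra hcon
    simp only [Set.mem_iUnion, not_exists] at hcon
    have hiff : ∀ j, prefixWord M x ∈ S' j ↔ f x = j := fun j => by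
      have := hcon j
      rw [← hS' j, Set.mem_symmDiff] at this
      simp only [Set.mem_preimage, Set.mem_singleton_iff] at this
      tauto
    have hex : ∃ j, prefixWord M x ∈ S' j := ⟨f x, (hiff _).2 rfl⟩
    apply hx
    simp only [hex, dite_true]
    exact ((hiff _).1 hex.choose_spec).symm
  calc ν.real _ ≤ ν.real (⋃ j, symmDiff (prefixWord (m j) ⁻¹' S j) (f ⁻¹' {j})) :=
        measureReal_mono hsub
    _ ≤ ∑ j, ν.real (symmDiff (prefixWord (m j) ⁻¹' S j) (f ⁻¹' {j})) :=
        measureReal_iUnion_fintype_le _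
    _ < ∑ _j : Fin k, ε / k := Finset.sum_lt_sum_of_nonempty Finset.univ_nonempty fun j _ => hS j
    _ = ε := by simp; field_simp

/-- Entropy of the distribution of the first `n` symbols. -/
abbrev blockEntropy (ν : Measure (Sigma N)) (n : ℕ) : ℝ := shannon ν (prefixWord n)

lemma joinEntropy_shift_eq_blockEntropy (ν : Measure (Sigma N)) :
    joinEntropy shift ν (fun x => x 0) = blockEntropy ν := by
  ext n
  rw [joinEntropy_eq_shannon, itinerary_shift_eq_prefixWord]

lemma sum_pi_kernel_le_one {k n : ℕ} (κ : Fin n → Fin k → ℝ) (h : ∀ j, ∑ a, κ j a = 1) :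
    ∑ w : Fin n → Fin k, ∏ j, κ j (w j) ≤ 1 := by
  rw [← Fintype.prod_sum fun j a => κ j a]
  simp [h]

variable {ν : Measure (Sigma N)} [IsProbabilityMeasure ν]

lemma subadditive_blockEntropy (hν : MeasurePreserving shift ν ν) :
    Subadditive (blockEntropy ν) := by
  rw [← joinEntropy_shift_eq_blockEntropy]
  exact subadditive_joinEntropy hν (measurable_pi_apply 0)

/-- The entropy of any itinerary is controlled by the block entropy of the coordinates. -/
lemma exists_joinEntropy_le (hν : MeasurePreserving shift ν ν) {k : ℕ} {f : Sigma N → Fin k}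
    (hf : Measurable f) {ε : ℝ} (hε : 0 < ε) :
    ∃ m, ∀ n, joinEntropy shift ν f n ≤ blockEntropy ν (n + m) + n * ε := by
  have : Nonempty (Sigma N) := nonempty_of_isProbabilityMeasure ν
  have : NeZero k := ⟨fun h => by subst h; exact (f (Classical.arbitrary _)).elim0⟩
  have hk : (1 : ℝ) ≤ k := Nat.one_le_cast.2 (NeZero.one_le)
  set c : ℝ := Real.exp (-(ε / 2)) with hc
  have hc1 : c < 1 := Real.exp_lt_one_iff.2 (by linarith)
  have hc0 : 0 < c := Real.exp_pos _
  -- Given a guess `i`, the kernel puts mass `c` on it and spreads the rest uniformly. Since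
  -- $c=e^{-\varepsilon/2}$, a correct guess costs at most $\varepsilon/2$ and a wrong one costs
  -- `L`.
  set κ : Fin k → Fin k → ℝ := fun i a => (1 - c) / k + if i = a then c else 0 with hκdef
  have hr : 0 < (1 - c) / k := div_pos (by linarith) (by linarith)
  have hκ : ∀ i a, 0 < κ i a := fun i a => by simp only [hκdef]; split_ifs <;> positivity
  have hκsum : ∀ i, ∑ a, κ i a = 1 := fun i => by
    simp only [hκdef, Finset.sum_add_distrib, Finset.sum_ite_eq, Finset.mem_univ, if_true,
      Finset.sum_const, Finset.card_univ, Fintype.card_fin, nsmul_eq_mul]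
    field_simp
    ring
  set L : ℝ := -Real.log ((1 - c) / k) with hL
  have hL0 : 0 ≤ L := by
    rw [hL, neg_nonneg]
    refine Real.log_nonpos hr.le ?_
    rw [div_le_one (by linarith)]; linarith
  have hcost : ∀ i a, -Real.log (κ i a) ≤ ε / 2 + if i ≠ a then L else 0 := by
    intro i a
    by_cases h : i = a
    · have : -(ε / 2) ≤ Real.log (κ i a) := by
        rw [← Real.log_exp (-(ε / 2))]
        refine Real.log_le_log (Real.exp_pos _) ?_
        simp only [hκdef, h, if_true]; linarith
      simp [h] at this ⊢; linarith
    · have : κ i a = (1 - c) / k := by simp [hκdef, h]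
      rw [this]; simp only [ne_eq, h, not_false_eq_true, if_true]; linarith
  -- With this error probability wrong guesses cost at most $\varepsilon/2$ on average; `L + 1` is
  -- used because `L` may vanish.
  obtain ⟨m, g, hg⟩ := exists_prefixWord_ne_lt ν hf (ε := ε / 2 / (L + 1)) (by positivity)
  refine ⟨m, fun n => ?_⟩
  have hV := measurable_prefixWord (N := N) (n + m)
  have hY := measurable_itinerary (measurable_shift (N := N)) hf n
  -- The guess for the itinerary at time `j` uses the window of length `m` starting at `j`, so `n +
  -- m` symbols determine all `n` guesses.
  set G : Fin n → (Fin (n + m) → Fin N) → Fin k := fun j v => g fun i => v ⟨j + i, by omega⟩ with hG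
  have hGx : ∀ j x, G j (prefixWord (n + m) x) = g (prefixWord m (shift^[j] x)) := fun j x => by
    simp only [hG]; congr 1; ext i; simp [prefixWord, iterate_shift_apply, add_comm]
  have hpair : Measurable fun x => (g (prefixWord m x), f x) :=
    ((measurable_of_finite g).comp (measurable_prefixWord m)).prodMk hf
  have hms : MeasurableSet {x | g (prefixWord m x) ≠ f x} :=
    hpair (t := {z | z.1 ≠ z.2}) (Set.toFinite _).measurableSet
  have hint : ∫ x, -Real.log (κ (g (prefixWord m x)) (f x)) ∂ν ≤ ε := by
    calc ∫ x, -Real.log (κ (g (prefixWord m x)) (f x)) ∂ν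
        ≤ ∫ x, (ε / 2 + {x | g (prefixWord m x) ≠ f x}.indicator (fun _ => L) x) ∂ν := by
          refine integral_mono (integrable_comp_fintype ν hpair fun z => -Real.log (κ z.1 z.2))
            ((integrable_const _).add ((integrable_const L).indicator hms))
            fun x => ?_
          simpa [Set.indicator_apply] using hcost (g (prefixWord m x)) (f x)
      _ = ε / 2 + ν.real {x | g (prefixWord m x) ≠ f x} * L := by
          rw [integral_add (integrable_const _) ((integrable_const L).indicator hms),
            integral_indicator_const _ hms]
          simp
      _ ≤ ε / 2 + ε / 2 / (L + 1) * (L + 1) := by gcongr; linarith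
      _ = ε := by field_simp; ring
  calc joinEntropy shift ν f n = shannon ν (itinerary shift f n) := joinEntropy_eq_shannon _ _ _ _
    _ ≤ shannon ν (fun x => (itinerary shift f n x, prefixWord (n + m) x)) :=
        shannon_comp_le ν (hY.prodMk hV) Prod.fst
    _ ≤ blockEntropy ν (n + m) +
        ∫ x, -Real.log (∏ j, κ (G j (prefixWord (n + m) x)) (itinerary shift f n x j)) ∂ν :=
        shannon_le_add_integral_log_kernel ν hY hV (fun v w => ∏ j, κ (G j v) (w j))
          (fun v w => Finset.prod_pos fun j _ => hκ _ _)
          (fun v => sum_pi_kernel_le_one (fun j => κ (G j v)) fun j => hκsum _)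
    _ = blockEntropy ν (n + m) +
        ∑ j : Fin n, ∫ x, -Real.log (κ (g (prefixWord m (shift^[j] x))) (f (shift^[j] x))) ∂ν := by
        congr 1
        rw [← integral_finsetSum]
        · congr 1; ext x
          rw [Real.log_prod fun j _ => (hκ _ _).ne']
          simp [hGx, itinerary]
        · intro j _
          exact integrable_comp_fintype ν (hpair.comp (measurable_shift.iterate j))
            fun z => -Real.log (κ z.1 z.2)
    _ = blockEntropy ν (n + m) +
        ∑ j : Fin n, ∫ x, -Real.log (κ (g (prefixWord m x)) (f x)) ∂ν := by
        congr 1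
        refine Finset.sum_congr rfl fun j _ => ?_
        have hmp := hν.iterate j
        conv_rhs => rw [← hmp.map_eq]
        rw [integral_map hmp.measurable.aemeasurable]
        exact ((measurable_of_finite fun z : Fin k × Fin k => -Real.log (κ z.1 z.2)).comp
          hpair).aestronglyMeasurable
    _ ≤ blockEntropy ν (n + m) + n * ε := by
        simp only [Finset.sum_const, Finset.card_univ, Fintype.card_fin, nsmul_eq_mul]
        gcongr

/-- **Kolmogorov–Sinai theorem** for the shift: the entropy is the growth rate of the block
entropies. -/
theorem entropy_shift_eq {h : ℝ} (hν : MeasurePreserving shift ν ν)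
    (hh : Tendsto (fun n : ℕ => blockEntropy ν n / n) atTop (𝓝 h)) :
    entropy shift ν = (h : EReal) := by
  apply le_antisymm
  · refine iSup_le fun k => iSup_le fun f => iSup_le fun hf => ?_
    refine EReal.le_of_forall_lt_iff_le.1 fun r hr => ?_
    rw [EReal.coe_lt_coe_iff] at hr
    obtain ⟨m, hm⟩ := exists_joinEntropy_le hν hf (ε := r - h) (by linarith)
    have hlim : Tendsto (fun n : ℕ => blockEntropy ν (n + m) / n + (r - h)) atTop (𝓝 r) := by
      have h1 : Tendsto
          (fun n : ℕ => blockEntropy ν (n + m) / ((n + m : ℕ) : ℝ) * ((n + m : ℕ) / n : ℝ))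
          atTop (𝓝 (h * 1)) := by
        refine ((tendsto_add_atTop_iff_nat m).2 hh).mul ?_
        have : Tendsto (fun n : ℕ => 1 + (m : ℝ) / n) atTop (𝓝 (1 + 0)) :=
          tendsto_const_nhds.add (tendsto_const_div_atTop_nhds_zero_nat (m : ℝ))
        rw [add_zero] at this
        refine this.congr' ((eventually_gt_atTop 0).mono fun n hn => ?_)
        have : (n : ℝ) ≠ 0 := by positivity
        push_cast; field_simp
      have h2 := h1.add_const (r - h)
      rw [mul_one, add_sub_cancel] at h2
      refine h2.congr' ((eventually_gt_atTop 0).mono fun n hn => ?_)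
      have h0 : (n : ℝ) ≠ 0 := by positivity
      have h0' : ((n + m : ℕ) : ℝ) ≠ 0 := by positivity
      simp only
      congr 1
      field_simp
    have hlim' : Tendsto (fun n : ℕ => ((blockEntropy ν (n + m) / n + (r - h) : ℝ) : EReal)) atTop
        (𝓝 (r : EReal)) := (continuous_coe_real_ereal.tendsto r).comp hlim
    rw [← hlim'.limsup_eq]
    refine limsup_le_limsup ((eventually_gt_atTop 0).mono fun n hn => ?_)
    rw [EReal.coe_le_coe_iff]
    have h0 : (0 : ℝ) < n := by positivity
    rw [div_le_iff₀ h0, add_mul, div_mul_cancel₀ _ h0.ne']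
    linarith [hm n]
  · have hlim : Tendsto (fun n : ℕ => ((blockEntropy ν n / n : ℝ) : EReal)) atTop (𝓝 (h : EReal)) :=
      (continuous_coe_real_ereal.tendsto h).comp hh
    rw [← hlim.limsup_eq, ← joinEntropy_shift_eq_blockEntropy]
    exact le_iSup_of_le N <| le_iSup_of_le (fun x => x 0) <|
      le_iSup_of_le (measurable_pi_apply 0) le_rfl

lemma bddBelow_blockEntropy_div : BddBelow (Set.range fun n : ℕ => blockEntropy ν n / n) := by
  rw [← joinEntropy_shift_eq_blockEntropy]
  exact bddBelow_joinEntropy_div _ _ _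

lemma tendsto_blockEntropy_div (hν : MeasurePreserving shift ν ν) :
    Tendsto (fun n : ℕ => blockEntropy ν n / n) atTop (𝓝 (subadditive_blockEntropy hν).lim) :=
  (subadditive_blockEntropy hν).tendsto_lim bddBelow_blockEntropy_div

/-- The entropy is a lower bound for all the normalized block entropies. -/
lemma mul_le_blockEntropy {h : ℝ} (hν : MeasurePreserving shift ν ν)
    (hh : entropy shift ν = (h : EReal)) (n : ℕ) : n * h ≤ blockEntropy ν n := by
  rcases eq_or_ne n 0 with rfl | hn
  · simpa using shannon_nonneg ν _
  rw [entropy_shift_eq hν (tendsto_blockEntropy_div hν), EReal.coe_eq_coe_iff] at hh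
  have := (subadditive_blockEntropy hν).lim_le_div bddBelow_blockEntropy_div hn
  rw [hh, le_div_iff₀ (by positivity)] at this
  linarith

end Prefix

/-! ### Gibbs measures and uniqueness of equilibrium states. -/

section Gibbs

variable {N : ℕ} {Φ : List (Fin N) → ℝ}

/-- `μ` is a Gibbs measure of `Φ` with pressure `P`: the measure of each cylinder agrees with
`Φ w * exp (-n * P)` up to a multiplicative error of at most `exp K`. -/
structure IsGibbs (Φ : List (Fin N) → ℝ) (P K : ℝ) (μ : Measure (Sigma N)) : Prop where
  measureReal_pos : ∀ n (w : Fin n → Fin N), 0 < μ.real (prefixWord n ⁻¹' {w})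
  abs_sub_le : ∀ n (w : Fin n → Fin N),
    |Real.log (Φ (List.ofFn w)) - n * P - Real.log (μ.real (prefixWord n ⁻¹' {w}))| ≤ K

lemma tendsto_div_of_abs_sub_le {a b : ℕ → ℝ} {K l : ℝ} (h : ∀ n, |a n - b n| ≤ K)
    (hb : Tendsto (fun n : ℕ => b n / n) atTop (𝓝 l)) :
    Tendsto (fun n : ℕ => a n / n) atTop (𝓝 l) := by
  have h0 : Tendsto (fun n : ℕ => (a n - b n) / n) atTop (𝓝 0) := by
    refine squeeze_zero_norm (fun n => ?_) (tendsto_const_div_atTop_nhds_zero_nat K)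
    rw [norm_div, Real.norm_eq_abs, Real.norm_natCast]
    gcongr
    exact h n
  simpa [sub_div] using h0.add hb

lemma tendsto_natCast_mul_div (P : ℝ) : Tendsto (fun n : ℕ => (n * P) / n) atTop (𝓝 P) :=
  tendsto_const_nhds.congr' ((eventually_gt_atTop 0).mono fun n hn => by
    have : (n : ℝ) ≠ 0 := by positivity
    field_simp)

/-- Integral of `log Φ` over the words of length `n`. -/
def logIntegral (Φ : List (Fin N) → ℝ) (ν : Measure (Sigma N)) (n : ℕ) : ℝ :=
  ∫ x, Real.log (Φ (trunc x n)) ∂ν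

lemma logIntegral_eq_sum (ν : Measure (Sigma N)) [IsFiniteMeasure ν] (n : ℕ) :
    logIntegral Φ ν n =
      ∑ w, ν.real (prefixWord n ⁻¹' {w}) * Real.log (Φ (List.ofFn w)) :=
  integral_comp_fintype ν (measurable_prefixWord n) fun w => Real.log (Φ (List.ofFn w))

lemma trunc_add (x : Sigma N) (m n : ℕ) : trunc x (m + n) = trunc x m ++ trunc (shift^[m] x) n := by
  rw [trunc, trunc, trunc, ← List.ofFn_fin_append]
  congr 1
  ext j
  refine Fin.addCases (fun i => ?_) (fun i => ?_) j
  · simp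
  · simp [iterate_shift_apply, add_comm]

lemma subadditive_logIntegral (hΦ : IsSubmultiplicativePotential Φ) {ν : Measure (Sigma N)}
    [IsFiniteMeasure ν] (hν : MeasurePreserving shift ν ν) : Subadditive (logIntegral Φ ν) := by
  intro m n
  have hint : ∀ n, Integrable (fun x => Real.log (Φ (trunc x n))) ν := fun n =>
    integrable_comp_fintype ν (measurable_prefixWord n) fun w => Real.log (Φ (List.ofFn w))
  have hm := hν.iterate m
  have hint' : Integrable (fun x => Real.log (Φ (trunc (shift^[m] x) n))) ν :=
    hm.integrable_comp_of_integrable (hint n)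
  have heq : logIntegral Φ ν n = ∫ x, Real.log (Φ (trunc (shift^[m] x) n)) ∂ν := by
    rw [logIntegral]
    conv_lhs => rw [← hm.map_eq]
    exact integral_map hm.measurable.aemeasurable (hm.map_eq.symm ▸ (hint n).aestronglyMeasurable)
  rw [heq, logIntegral, logIntegral, ← integral_add (hint m) hint']
  refine integral_mono (hint _) ((hint m).add hint') fun x => ?_
  simp only [trunc_add]
  rw [← Real.log_mul (hΦ.1 _).ne' (hΦ.1 _).ne']
  exact Real.log_le_log (hΦ.1 _) (hΦ.2 _ _)

/-- The ergodic average is a lower bound for the normalized integrals of `log Φ`. -/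
lemma mul_le_logIntegral (hΦ : IsSubmultiplicativePotential Φ) {ν : Measure (Sigma N)}
    [IsFiniteMeasure ν] (hν : MeasurePreserving shift ν ν) {l : ℝ}
    (hl : HasErgodicAverage Φ ν l) (n : ℕ) : n * l ≤ logIntegral Φ ν n := by
  have hsub := subadditive_logIntegral hΦ hν
  have hl' : Tendsto (fun n : ℕ => logIntegral Φ ν n / n) atTop (𝓝 l) := hl
  rcases eq_or_ne n 0 with rfl | hn
  · have := hsub 0 0
    simp only [add_zero] at this
    simp only [Nat.cast_zero, zero_mul]
    linarith
  have hbdd := hl'.bddBelow_range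
  have := hsub.lim_le_div hbdd hn
  rw [tendsto_nhds_unique (hsub.tendsto_lim hbdd) hl', le_div_iff₀ (by positivity)] at this
  linarith

namespace IsGibbs

variable {P K : ℝ} {μ : Measure (Sigma N)} [IsProbabilityMeasure μ]

lemma hasPressure (hG : IsGibbs Φ P K μ) (hΦ : ∀ v, 0 < Φ v) : HasPressure Φ P := by
  refine tendsto_div_of_abs_sub_le (b := fun n : ℕ => n * P) (K := K) (fun n => ?_)
    (tendsto_natCast_mul_div P)
  have hsum := sum_measureReal_preimage_singleton_eq_one μ (measurable_prefixWord (N := N) n)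
  have hup : ∑ w : Fin n → Fin N, Φ (List.ofFn w) ≤ Real.exp (n * P + K) := by
    calc ∑ w : Fin n → Fin N, Φ (List.ofFn w)
        ≤ ∑ w : Fin n → Fin N, Real.exp (n * P + K) * μ.real (prefixWord n ⁻¹' {w}) := by
          refine Finset.sum_le_sum fun w _ => ?_
          have := (abs_le.1 (hG.abs_sub_le n w)).2
          rw [← Real.exp_log (hΦ (List.ofFn w)), ← Real.exp_log (hG.measureReal_pos n w),
            ← Real.exp_add]
          exact Real.exp_le_exp.2 (by linarith)
      _ = _ := by rw [← Finset.mul_sum, hsum, mul_one]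
  have hlow : Real.exp (n * P - K) ≤ ∑ w : Fin n → Fin N, Φ (List.ofFn w) := by
    calc Real.exp (n * P - K)
        = ∑ w : Fin n → Fin N, Real.exp (n * P - K) * μ.real (prefixWord n ⁻¹' {w}) := by
          rw [← Finset.mul_sum, hsum, mul_one]
      _ ≤ _ := by
          refine Finset.sum_le_sum fun w _ => ?_
          have := (abs_le.1 (hG.abs_sub_le n w)).1
          rw [← Real.exp_log (hΦ (List.ofFn w)), ← Real.exp_log (hG.measureReal_pos n w),
            ← Real.exp_add]
          exact Real.exp_le_exp.2 (by linarith)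
  have hpos := (Real.exp_pos _).trans_le hlow
  have h1 := (Real.le_log_iff_exp_le hpos).2 hlow
  have h2 := (Real.log_le_iff_le_exp hpos).2 hup
  exact abs_le.2 ⟨by linarith, by linarith⟩

/-- Integrating the Gibbs estimate against `μ` shows that $\int\log\Phi_n\,d\mu$ differs from
$nP-H_n(\mu)$ by at most `K`, so the ergodic average is $P-h(\mu)$. -/
lemma isEquilibriumState (hG : IsGibbs Φ P K μ) (hΦ : ∀ v, 0 < Φ v)
    (hμ : MeasurePreserving shift μ μ) : IsEquilibriumState Φ μ := by
  have hh := tendsto_blockEntropy_div hμ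
  refine ⟨inferInstance, hμ, P, _, P - _, hG.hasPressure hΦ, entropy_shift_eq hμ hh, ?_,
    (add_sub_cancel _ _).symm⟩
  refine tendsto_div_of_abs_sub_le (a := logIntegral Φ μ)
    (b := fun n : ℕ => n * P - blockEntropy μ n) (K := K) (fun n => ?_) ?_
  · have hsum := sum_measureReal_preimage_singleton_eq_one μ (measurable_prefixWord (N := N) n)
    have heq : logIntegral Φ μ n - (n * P - blockEntropy μ n) =
        ∑ w, μ.real (prefixWord n ⁻¹' {w}) * (Real.log (Φ (List.ofFn w)) - n * P -
          Real.log (μ.real (prefixWord n ⁻¹' {w}))) := by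
      simp only [mul_sub, Finset.sum_sub_distrib, ← Finset.sum_mul, hsum, one_mul,
        logIntegral_eq_sum, blockEntropy, shannon, Real.negMulLog, neg_mul, Finset.sum_neg_distrib]
      ring
    rw [heq]
    calc |_| ≤ ∑ w, |μ.real (prefixWord n ⁻¹' {w}) * (Real.log (Φ (List.ofFn w)) - n * P -
          Real.log (μ.real (prefixWord n ⁻¹' {w})))| := Finset.abs_sum_le_sum_abs _ _
      _ ≤ ∑ w, μ.real (prefixWord n ⁻¹' {w}) * K := by
          refine Finset.sum_le_sum fun w _ => ?_
          rw [abs_mul, abs_of_nonneg measureReal_nonneg]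
          exact mul_le_mul_of_nonneg_left (hG.abs_sub_le n w) measureReal_nonneg
      _ = K := by rw [← Finset.sum_mul, hsum, one_mul]
  · simp only [sub_div]
    exact (tendsto_natCast_mul_div P).sub hh

/-- An equilibrium state gives little mass to unions of cylinders of small Gibbs measure. -/
lemma measureReal_mul_neg_log_le (hG : IsGibbs Φ P K μ) {ν : Measure (Sigma N)}
    [IsProbabilityMeasure ν] {n : ℕ} (hν : n * P ≤ blockEntropy ν n + logIntegral Φ ν n)
    (S : Set (Fin n → Fin N)) {δ : ℝ} (hδ : 0 < δ) (hS : μ.real (prefixWord n ⁻¹' S) ≤ δ) :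
    ν.real (prefixWord n ⁻¹' S) * -Real.log δ ≤ K + Real.log 2 := by
  classical
  have hmeas := measurable_prefixWord (N := N) n
  have hsumμ := sum_measureReal_preimage_singleton_eq_one μ hmeas
  have hsumν := sum_measureReal_preimage_singleton_eq_one ν hmeas
  have hind : ∀ (ρ : Measure (Sigma N)) [IsProbabilityMeasure ρ],
      ∑ w, ρ.real (prefixWord n ⁻¹' {w}) * (if w ∈ S then 1 else 0) =
        ρ.real (prefixWord n ⁻¹' S) := by
    intro ρ _
    rw [← integral_comp_fintype ρ hmeas fun w => if w ∈ S then (1 : ℝ) else 0]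
    have := integral_indicator_one (μ := ρ) (hmeas (Set.toFinite S).measurableSet)
    rw [← this]
    rfl
  -- The reference weights for Gibbs' inequality are half of `μ`, boosted by `δ⁻¹` on `S`. The
  -- hypothesis on `μ` of `S` keeps their sum at most 1, and each word of `S` gains `-log δ`.
  set q : (Fin n → Fin N) → ℝ := fun w =>
    μ.real (prefixWord n ⁻¹' {w}) * (2⁻¹ * if w ∈ S then δ⁻¹ else 1) with hq
  have hqpos : ∀ w, 0 < q w := fun w =>
    mul_pos (hG.measureReal_pos n w) (by split_ifs <;> positivity)
  have hqsum : ∑ w, q w ≤ 1 := by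
    calc ∑ w, q w ≤ ∑ w, (2⁻¹ * μ.real (prefixWord n ⁻¹' {w}) + 2⁻¹ * δ⁻¹ *
          (μ.real (prefixWord n ⁻¹' {w}) * (if w ∈ S then 1 else 0))) := by
          refine Finset.sum_le_sum fun w _ => ?_
          have := hG.measureReal_pos n w
          simp only [hq]
          split_ifs <;> linarith
      _ = 2⁻¹ + 2⁻¹ * (δ⁻¹ * μ.real (prefixWord n ⁻¹' S)) := by
          rw [Finset.sum_add_distrib, ← Finset.mul_sum, ← Finset.mul_sum, hsumμ, hind μ]; ring
      _ ≤ 2⁻¹ + 2⁻¹ * (δ⁻¹ * δ) := by gcongr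
      _ = 1 := by rw [inv_mul_cancel₀ hδ.ne']; norm_num
  have hH := shannon_le_of_sum_le_one ν hmeas q (fun w => (hqpos w).le) hqsum fun w _ => hqpos w
  have hcomb : blockEntropy ν n + logIntegral Φ ν n ≤ n * P + K + Real.log 2 +
      ν.real (prefixWord n ⁻¹' S) * Real.log δ := by
    calc blockEntropy ν n + logIntegral Φ ν n
        ≤ ∑ w, ν.real (prefixWord n ⁻¹' {w}) * (-Real.log (q w) + Real.log (Φ (List.ofFn w))) := by
          rw [logIntegral_eq_sum]
          simp only [mul_add, Finset.sum_add_distrib]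
          gcongr
      _ ≤ ∑ w, (ν.real (prefixWord n ⁻¹' {w}) * (n * P + K + Real.log 2) +
            ν.real (prefixWord n ⁻¹' {w}) * (if w ∈ S then 1 else 0) * Real.log δ) := by
          refine Finset.sum_le_sum fun w _ => ?_
          rw [mul_assoc, ← mul_add]
          refine mul_le_mul_of_nonneg_left ?_ measureReal_nonneg
          have hlogq : Real.log (q w) = Real.log (μ.real (prefixWord n ⁻¹' {w})) - Real.log 2 -
              (if w ∈ S then 1 else 0) * Real.log δ := by
            simp only [hq]
            rw [Real.log_mul (hG.measureReal_pos n w).ne' (by split_ifs <;> positivity),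
              Real.log_mul (by norm_num) (by split_ifs <;> positivity), Real.log_inv]
            split_ifs
            · rw [Real.log_inv]; ring
            · simp; ring
          have := (abs_le.1 (hG.abs_sub_le n w)).2
          rw [hlogq]
          linarith
      _ = _ := by
          rw [Finset.sum_add_distrib, ← Finset.sum_mul, ← Finset.sum_mul, hsumν, hind ν]; ring
  linarith

/-- A `μ`-null set is approximated, for `μ` and `ν` at once, by a union of cylinders of `μ`-measure
at most $e^{-t}$. The preceding bound gives it `ν`-measure $O(1/t)$, and `t` is arbitrary. -/
lemma absolutelyContinuous (hG : IsGibbs Φ P K μ) {ν : Measure (Sigma N)} [IsProbabilityMeasure ν]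
    (hν : ∀ n : ℕ, n * P ≤ blockEntropy ν n + logIntegral Φ ν n) : ν ≪ μ := by
  refine Measure.AbsolutelyContinuous.mk fun E hE hE0 => ?_
  have key : ∀ t : ℝ, 0 < t → t * ν.real E ≤ K + Real.log 2 + 1 := by
    intro t ht
    obtain ⟨m, S, hS⟩ := exists_prefixWord_symmDiff_lt (μ + ν) hE (Real.exp_pos (-t))
    rw [measureReal_add_apply] at hS
    have hμS : μ.real (prefixWord m ⁻¹' S) ≤ Real.exp (-t) := by
      have h1 : μ.real (prefixWord m ⁻¹' S) ≤ μ.real (symmDiff (prefixWord m ⁻¹' S) E ∪ E) :=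
        measureReal_mono fun x hx => by
          by_cases hxE : x ∈ E
          · exact Or.inr hxE
          · exact Or.inl (Or.inl ⟨hx, hxE⟩)
      have h2 := measureReal_union_le (μ := μ) (symmDiff (prefixWord m ⁻¹' S) E) E
      have h3 : μ.real E = 0 := by simp [Measure.real, hE0]
      have h4 : 0 ≤ ν.real (symmDiff (prefixWord m ⁻¹' S) E) := measureReal_nonneg
      linarith
    have hνE : ν.real E ≤ ν.real (prefixWord m ⁻¹' S) + Real.exp (-t) := by
      have h1 : ν.real E ≤ ν.real (symmDiff (prefixWord m ⁻¹' S) E ∪ prefixWord m ⁻¹' S) :=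
        measureReal_mono fun x hx => by
          by_cases hxS : x ∈ prefixWord m ⁻¹' S
          · exact Or.inr hxS
          · exact Or.inl (Or.inr ⟨hx, hxS⟩)
      have h2 := measureReal_union_le (μ := ν) (symmDiff (prefixWord m ⁻¹' S) E)
        (prefixWord m ⁻¹' S)
      have h4 : 0 ≤ μ.real (symmDiff (prefixWord m ⁻¹' S) E) := measureReal_nonneg
      linarith
    have h := hG.measureReal_mul_neg_log_le (hν m) S (Real.exp_pos _) hμS
    rw [Real.log_exp, neg_neg] at h
    have hexp : t * Real.exp (-t) ≤ 1 := by
      have := Real.add_one_le_exp t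
      rw [Real.exp_neg, ← div_eq_mul_inv, div_le_one (Real.exp_pos _)]
      linarith
    calc t * ν.real E ≤ t * (ν.real (prefixWord m ⁻¹' S) + Real.exp (-t)) := by gcongr
      _ ≤ _ := by linarith
  have hzero : ν.real E = 0 := by
    by_contra hne
    have hpos : 0 < ν.real E := lt_of_le_of_ne measureReal_nonneg (Ne.symm hne)
    have h1 := key 1 one_pos
    have hC : 0 < K + Real.log 2 + 1 := by linarith
    have := key ((K + Real.log 2 + 1 + 1) / ν.real E) (by positivity)
    rw [div_mul_cancel₀ _ hne] at this
    linarith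
  exact (measureReal_eq_zero_iff (measure_ne_top _ _)).1 hzero

/-- An ergodic Gibbs measure of a submultiplicative potential is its only equilibrium state. -/
theorem isEquilibriumState_iff (hG : IsGibbs Φ P K μ) (hΦ : IsSubmultiplicativePotential Φ)
    (hμ : Ergodic shift μ) {ν : Measure (Sigma N)} : IsEquilibriumState Φ ν ↔ ν = μ := by
  constructor
  · rintro ⟨hprob, hν, p, h, l, hp, hh, hl, rfl⟩
    have hP := tendsto_nhds_unique hp (hG.hasPressure hΦ.1)
    refine hμ.eq_of_absolutelyContinuous hν (hG.absolutelyContinuous fun n => ?_)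
    have h1 := mul_le_blockEntropy hν hh n
    have h2 := mul_le_logIntegral hΦ hν hl n
    rw [← hP, mul_add]
    linarith
  · rintro rfl
    exact hG.isEquilibriumState hΦ.1 hμ.toMeasurePreserving

end IsGibbs

end Gibbs

/-! ### Independence of head and tail for i.i.d. sequences. -/

section Sequences

variable {N : ℕ}

/-- Prepend an element to a sequence. -/
def seqCons {α : Type*} (z : α × (ℕ → α)) : ℕ → α
  | 0 => z.1
  | n + 1 => z.2 n

lemma measurable_seqCons {α : Type*} [MeasurableSpace α] :
    Measurable (seqCons (α := α)) :=
  measurable_pi_lambda _ fun n => by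
    cases n with
    | zero => exact measurable_fst
    | succ n => exact (measurable_pi_apply n).comp measurable_snd

lemma map_seqCons_infinitePi {α : Type*} [MeasurableSpace α] (ρ : Measure α)
    [IsProbabilityMeasure ρ] :
    (ρ.prod (Measure.infinitePi fun _ : ℕ => ρ)).map seqCons =
      Measure.infinitePi fun _ : ℕ => ρ := by
  classical
  refine Measure.eq_infinitePi _ fun s t ht => ?_
  -- Constraints on a finite set of coordinates are padded to an initial segment, which splits into
  -- coordinate 0 and a shifted segment.
  set t' : ℕ → Set α := fun n => if n ∈ s then t n else Set.univ with ht'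
  have hmt' : ∀ n, MeasurableSet (t' n) := fun n => by
    simp only [ht']; split_ifs; exacts [ht n, .univ]
  set M := s.sup id
  have hM : ∀ n ∈ s, n < M + 1 := fun n hn => Nat.lt_succ_of_le (Finset.le_sup (f := id) hn)
  have hset : Set.pi s t = Set.pi (Finset.range (M + 1)) t' := by
    ext x
    simp only [Set.mem_pi, Finset.mem_coe, Finset.mem_range, ht']
    refine ⟨fun h n _ => ?_, fun h n hn => by simpa [hn] using h n (hM n hn)⟩
    split_ifs with hns
    exacts [h n hns, trivial]
  have hprod : ∏ n ∈ s, ρ (t n) = ∏ n ∈ Finset.range (M + 1), ρ (t' n) := by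
    rw [← Finset.prod_subset (fun n hn => Finset.mem_range.2 (hM n hn))
      (fun n _ hn => by simp [ht', hn])]
    exact Finset.prod_congr rfl fun n hn => by simp [ht', hn]
  have hpre : seqCons ⁻¹' Set.pi (Finset.range (M + 1)) t' =
      t' 0 ×ˢ Set.pi (Finset.range M) fun n => t' (n + 1) := by
    ext ⟨a, u⟩
    simp only [Set.mem_preimage, Set.mem_pi, Finset.mem_coe, Finset.mem_range, Set.mem_prod]
    refine ⟨fun h => ⟨h 0 (by omega), fun n hn => h (n + 1) (by omega)⟩, fun h n hn => ?_⟩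
    cases n with
    | zero => exact h.1
    | succ n => exact h.2 n (by omega)
  rw [hset, Measure.map_apply measurable_seqCons
    (MeasurableSet.pi (Finset.countable_toSet _) fun n _ => hmt' n), hpre, Measure.prod_prod,
    Measure.infinitePi_pi _ fun n _ => hmt' (n + 1), hprod, Finset.prod_range_succ', mul_comm]

lemma infinitePi_head_tail {α : Type*} [MeasurableSpace α] (ρ : Measure α)
    [IsProbabilityMeasure ρ] {A : Set α} {B : Set (ℕ → α)} (hA : MeasurableSet A)
    (hB : MeasurableSet B) :
    (Measure.infinitePi fun _ : ℕ => ρ) {u | u 0 ∈ A ∧ (fun n => u (n + 1)) ∈ B} =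
      ρ A * (Measure.infinitePi fun _ : ℕ => ρ) B := by
  have hm : MeasurableSet {u : ℕ → α | u 0 ∈ A ∧ (fun n => u (n + 1)) ∈ B} :=
    (measurable_pi_apply 0 hA).inter
      (measurable_pi_lambda (fun (u : ℕ → α) n => u (n + 1)) (fun n => measurable_pi_apply _) hB)
  conv_lhs => rw [← map_seqCons_infinitePi ρ]
  rw [Measure.map_apply measurable_seqCons hm, ← Measure.prod_prod]
  rfl

lemma preimage_prefixWord_succ {n : ℕ} (w : Fin (n + 1) → Fin N) :
    prefixWord (n + 1) ⁻¹' {w} =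
      {x : Sigma N | x 0 = w 0} ∩ shift ⁻¹' (prefixWord n ⁻¹' {Fin.tail w}) := by
  ext x
  simp [prefixWord, funext_iff, Fin.forall_fin_succ, shift, Fin.tail]

lemma measurableSet_head_eq (i : Fin N) : MeasurableSet {x : Sigma N | x 0 = i} :=
  measurableSet_eq_fun (measurable_pi_apply 0) measurable_const

end Sequences

/-! ### Reversible automata and their stationary measures. -/

/-- A finite automaton whose symbols act as involutions, with positive symmetric transition weights
and a positive eigenvector `r` of its transfer matrix. -/
structure ReversibleSystem (S : Type*) (N : ℕ) where
  /-- the state reached by reading a symbol -/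
  step : S → Fin N → S
  /-- the weight of a transition -/
  wt : S → Fin N → ℝ
  /-- the eigenvector -/
  r : S → ℝ
  /-- the eigenvalue -/
  eig : ℝ
  wt_pos : ∀ s i, 0 < wt s i
  r_pos : ∀ s, 0 < r s
  eig_pos : 0 < eig
  step_step : ∀ s i, step (step s i) i = s
  wt_step : ∀ s i, wt (step s i) i = wt s i
  sum_wt_mul : ∀ s, ∑ i, wt s i * r (step s i) = eig * r s

namespace ReversibleSystem

variable {S : Type*} {N : ℕ} (R : ReversibleSystem S N)

/-- Probability of reading the symbol `i` in the state `s`. -/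
def prob (s : S) (i : Fin N) : ℝ := R.wt s i * R.r (R.step s i) / (R.eig * R.r s)

lemma prob_pos (s : S) (i : Fin N) : 0 < R.prob s i :=
  div_pos (mul_pos (R.wt_pos _ _) (R.r_pos _)) (mul_pos R.eig_pos (R.r_pos _))

lemma sum_prob (s : S) : ∑ i, R.prob s i = 1 := by
  simp only [prob, ← Finset.sum_div]
  rw [R.sum_wt_mul, div_self (mul_pos R.eig_pos (R.r_pos _)).ne']

/-- The law of the symbol read in the state `s`. -/
def symbolLaw (s : S) : Measure (Fin N) := ∑ i, ENNReal.ofReal (R.prob s i) • Measure.dirac i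

lemma symbolLaw_singleton (s : S) (i : Fin N) :
    R.symbolLaw s {i} = ENNReal.ofReal (R.prob s i) := by
  simp [symbolLaw, Set.indicator_apply]

instance (s : S) : IsProbabilityMeasure (R.symbolLaw s) := ⟨by
  simp only [symbolLaw, Measure.coe_finsetSum, Finset.sum_apply, Measure.smul_apply,
    measure_univ, smul_eq_mul, mul_one]
  rw [← ENNReal.ofReal_sum_of_nonneg fun i _ => (R.prob_pos s i).le, R.sum_prob,
    ENNReal.ofReal_one]⟩

/-- The product of the weights along the path which reads a word from the state `s`. -/
def pathWeight : S → List (Fin N) → ℝ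
  | _, [] => 1
  | s, i :: w => R.wt s i * pathWeight (R.step s i) w

/-- The state reached by reading a word. -/
def endState : S → List (Fin N) → S
  | s, [] => s
  | s, i :: w => endState (R.step s i) w

lemma pathWeight_pos (s : S) (w : List (Fin N)) : 0 < R.pathWeight s w := by
  induction w generalizing s with
  | nil => exact one_pos
  | cons i w ih => exact mul_pos (R.wt_pos _ _) (ih _)

/-- The sequence of symbols read from the state `s` when the choices are given by `u`. -/
def code : S → (ℕ → S → Fin N) → ℕ → Fin N
  | s, u, 0 => u 0 s
  | s, u, n + 1 => code (R.step s (u 0 s)) (fun k => u (k + 1)) n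

lemma measurable_code (s : S) : Measurable (R.code s) := by
  refine measurable_pi_lambda _ fun n => ?_
  induction n generalizing s with
  | zero => exact (measurable_pi_apply s).comp (measurable_pi_apply 0)
  | succ n ih =>
    -- The state from which the tail is read depends on the first symbol, so measurability is needed
    -- jointly in that symbol and the tail of the choices.
    have h1 : Measurable fun z : Fin N × (ℕ → S → Fin N) => R.code (R.step s z.1) z.2 n :=
      measurable_from_prod_countable_right fun i => ih (R.step s i)
    have h2 : Measurable fun u : ℕ → S → Fin N => (u 0 s, fun k => u (k + 1)) :=
      ((measurable_pi_apply s).comp (measurable_pi_apply 0)).prodMk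
        (measurable_pi_lambda _ fun k => measurable_pi_apply _)
    exact h1.comp h2

variable [Fintype S]

/-- The law of a random choice of symbols, one for each state. -/
def choiceLaw : Measure (S → Fin N) := Measure.pi R.symbolLaw

instance : IsProbabilityMeasure R.choiceLaw := inferInstanceAs (IsProbabilityMeasure (Measure.pi _))

/-- The law of a sequence of independent choices. -/
def source : Measure (ℕ → S → Fin N) := Measure.infinitePi fun _ => R.choiceLaw

instance : IsProbabilityMeasure R.source :=
  inferInstanceAs (IsProbabilityMeasure (Measure.infinitePi _))

/-- The law of the sequence of symbols read from the state `s`. -/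
def chain (s : S) : Measure (Sigma N) := R.source.map (R.code s)

instance (s : S) : IsProbabilityMeasure (R.chain s) :=
  Measure.isProbabilityMeasure_map (R.measurable_code s).aemeasurable

lemma choiceLaw_eval (s : S) (i : Fin N) :
    R.choiceLaw {f | f s = i} = ENNReal.ofReal (R.prob s i) := by
  have := (measurePreserving_eval R.symbolLaw s).measure_preimage
    (measurableSet_singleton i).nullMeasurableSet
  rw [R.symbolLaw_singleton] at this
  exact this

/-- The Markov property. -/
lemma chain_head_tail (s : S) (i : Fin N) {B : Set (Sigma N)} (hB : MeasurableSet B) :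
    R.chain s ({x | x 0 = i} ∩ shift ⁻¹' B) =
      ENNReal.ofReal (R.prob s i) * R.chain (R.step s i) B := by
  have hi := measurableSet_head_eq i
  rw [chain, chain, Measure.map_apply (R.measurable_code s) (hi.inter (measurable_shift hB)),
    Measure.map_apply (R.measurable_code _) hB, ← R.choiceLaw_eval s i]
  refine Eq.trans ?_ (infinitePi_head_tail R.choiceLaw (A := {f | f s = i})
    (measurableSet_eq_fun (measurable_pi_apply s) measurable_const)
    (R.measurable_code (R.step s i) hB))
  rw [source]
  congr 1
  ext u
  simp only [Set.mem_preimage, Set.mem_inter_iff, Set.mem_ofPred_eq]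
  refine and_congr_right fun h => ?_
  have h' : u 0 s = i := h
  have : shift (R.code s u) = R.code (R.step s i) fun n => u (n + 1) := by
    ext n; simp [shift, code, h']
  rw [this]

lemma chain_eq_sum (s : S) {B : Set (Sigma N)} (hB : MeasurableSet B) :
    R.chain s (shift ⁻¹' B) = ∑ i, ENNReal.ofReal (R.prob s i) * R.chain (R.step s i) B := by
  simp only [← R.chain_head_tail s _ hB]
  rw [← measure_biUnion_finset]
  · congr 1; ext x; simp
  · intro i _ j _ hij
    refine Set.disjoint_left.2 fun x hx hx' => hij ?_
    exact hx.1.symm.trans hx'.1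
  · exact fun i _ => (measurableSet_head_eq i).inter (measurable_shift hB)

/-- The factors `r (step s i) / r s` telescope along the path, leaving only the end states. -/
lemma measureReal_chain_prefixWord (s : S) (n : ℕ) (w : Fin n → Fin N) :
    (R.chain s).real (prefixWord n ⁻¹' {w}) = R.pathWeight s (List.ofFn w) *
      R.r (R.endState s (List.ofFn w)) / (R.eig ^ n * R.r s) := by
  have heig := R.eig_pos.ne'
  have hr := fun s => (R.r_pos s).ne'
  induction n generalizing s with
  | zero =>
    have : prefixWord 0 ⁻¹' {w} = (Set.univ : Set (Sigma N)) := by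
      ext x; simp [Subsingleton.elim (prefixWord 0 x) w]
    simp [this, pathWeight, endState, hr]
  | succ n ih =>
    rw [preimage_prefixWord_succ, Measure.real, R.chain_head_tail _ _
      (measurable_prefixWord n (measurableSet_singleton _)), ENNReal.toReal_mul,
      ENNReal.toReal_ofReal (R.prob_pos _ _).le, ← Measure.real, ih, List.ofFn_succ]
    have h1 := hr s
    have h2 := hr (R.step s (w 0))
    simp only [pathWeight, endState, prob, pow_succ]
    field_simp
    rfl

/-- Superposition of the chains started from the various states, with density `ρ` relative to the
reversible weights `r ^ 2`. -/
def mix (ρ : S → ℝ) : Measure (Sigma N) := ∑ s, ENNReal.ofReal (ρ s * R.r s ^ 2) • R.chain s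

lemma mix_apply (ρ : S → ℝ) (B : Set (Sigma N)) :
    R.mix ρ B = ∑ s, ENNReal.ofReal (ρ s * R.r s ^ 2) * R.chain s B := by
  simp [mix]

instance (ρ : S → ℝ) : IsFiniteMeasure (R.mix ρ) := ⟨by
  rw [mix_apply]
  exact ENNReal.sum_lt_top.2 fun s _ => ENNReal.mul_lt_top ENNReal.ofReal_lt_top
    (measure_lt_top _ _)⟩

lemma measureReal_mix {ρ : S → ℝ} (hρ : ∀ s, 0 ≤ ρ s) (B : Set (Sigma N)) :
    (R.mix ρ).real B = ∑ s, ρ s * R.r s ^ 2 * (R.chain s).real B := by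
  rw [Measure.real, mix_apply, ENNReal.toReal_sum fun s _ =>
    ENNReal.mul_ne_top ENNReal.ofReal_ne_top (measure_ne_top _ _)]
  refine Finset.sum_congr rfl fun s _ => ?_
  rw [ENNReal.toReal_mul, ENNReal.toReal_ofReal (mul_nonneg (hρ s) (sq_nonneg _)), Measure.real]

lemma mix_add {ρ ρ' : S → ℝ} (hρ : ∀ s, 0 ≤ ρ s) (hρ' : ∀ s, 0 ≤ ρ' s) :
    R.mix (ρ + ρ') = R.mix ρ + R.mix ρ' := by
  simp only [mix, ← Finset.sum_add_distrib, ← add_smul]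
  refine Finset.sum_congr rfl fun s _ => ?_
  rw [Pi.add_apply, add_mul, ENNReal.ofReal_add (mul_nonneg (hρ s) (sq_nonneg _))
    (mul_nonneg (hρ' s) (sq_nonneg _))]

/-- The permutation of the states induced by a symbol. -/
def stepPerm (i : Fin N) : Equiv.Perm S :=
  Function.Involutive.toPerm (fun s => R.step s i) fun s => R.step_step s i

/-- Detailed balance: $r(s)^2\,\mathrm{prob}(s,i)=\mathrm{wt}(s,i)\,r(s)\,r(t)/\mathrm{eig}$ is
symmetric in $s$ and $t=\mathrm{step}(s,i)$. Reindexing by the involution of each symbol carries the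
density `ρ` to `ρ'`. Constant densities give stationarity, parity classes the exchange of two
measures. -/
lemma map_shift_mix {ρ ρ' : S → ℝ} (hρ : ∀ s, 0 ≤ ρ s) (h : ∀ s i, ρ (R.step s i) = ρ' s) :
    (R.mix ρ).map shift = R.mix ρ' := by
  have hρ' : ∀ s, ∀ _ : Fin N, 0 ≤ ρ' s := fun s i => h s i ▸ hρ _
  ext B hB
  rw [Measure.map_apply measurable_shift hB, mix_apply, mix_apply]
  have hcoef : ∀ s i, ρ s * R.r s ^ 2 * R.prob s i =
      ρ' (R.step s i) * R.r (R.step s i) ^ 2 * R.prob (R.step s i) i := by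
    intro s i
    have h1 := (R.r_pos s).ne'
    have h2 := (R.r_pos (R.step s i)).ne'
    have h3 := R.eig_pos.ne'
    rw [← h (R.step s i) i, prob, prob, R.step_step, R.wt_step]
    field_simp
  calc ∑ s, ENNReal.ofReal (ρ s * R.r s ^ 2) * R.chain s (shift ⁻¹' B)
      = ∑ s, ∑ i, ENNReal.ofReal (ρ s * R.r s ^ 2 * R.prob s i) * R.chain (R.step s i) B := by
        refine Finset.sum_congr rfl fun s _ => ?_
        rw [R.chain_eq_sum s hB, Finset.mul_sum]
        refine Finset.sum_congr rfl fun i _ => ?_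
        rw [ENNReal.ofReal_mul (mul_nonneg (hρ s) (sq_nonneg _)), mul_assoc]
    _ = ∑ i, ∑ s, ENNReal.ofReal (ρ' (R.step s i) * R.r (R.step s i) ^ 2 *
          R.prob (R.step s i) i) * R.chain (R.step s i) B := by
        rw [Finset.sum_comm]; simp only [hcoef]
    _ = ∑ i, ∑ s, ENNReal.ofReal (ρ' s * R.r s ^ 2 * R.prob s i) * R.chain s B :=
        Finset.sum_congr rfl fun i _ => Equiv.sum_comp (R.stepPerm i) fun s =>
          ENNReal.ofReal (ρ' s * R.r s ^ 2 * R.prob s i) * R.chain s B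
    _ = ∑ s, ENNReal.ofReal (ρ' s * R.r s ^ 2) * R.chain s B := by
        rw [Finset.sum_comm]
        refine Finset.sum_congr rfl fun s _ => ?_
        rw [← Finset.sum_mul, ← ENNReal.ofReal_sum_of_nonneg fun i _ =>
          mul_nonneg (mul_nonneg (hρ' s i) (sq_nonneg _)) (R.prob_pos s i).le, ← Finset.mul_sum,
          R.sum_prob, mul_one]

/-- The total mass of the reversible weights. -/
def mass : ℝ := ∑ s, R.r s ^ 2

/-- The stationary measure. -/
def stationary : Measure (Sigma N) := R.mix fun _ => R.mass⁻¹

lemma measurePreserving_stationary : MeasurePreserving shift R.stationary R.stationary :=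
  ⟨measurable_shift, R.map_shift_mix
    (fun _ => inv_nonneg.2 (Finset.sum_nonneg fun _ _ => sq_nonneg _)) fun _ _ => rfl⟩

lemma mass_pos [Nonempty S] : 0 < R.mass :=
  Finset.sum_pos (fun s _ => pow_pos (R.r_pos s) 2) Finset.univ_nonempty

instance [Nonempty S] : IsProbabilityMeasure R.stationary := ⟨by
  rw [stationary, mix_apply]
  simp only [measure_univ, mul_one]
  rw [← ENNReal.ofReal_sum_of_nonneg fun s _ => mul_nonneg (inv_nonneg.2 R.mass_pos.le)
    (sq_nonneg _), ← Finset.mul_sum, ← mass, inv_mul_cancel₀ R.mass_pos.ne', ENNReal.ofReal_one]⟩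

/-! ### Ergodicity, the Gibbs property, and the second iterate of the shift. -/

section Ergodic

variable {R}

/-- Maximum principle: the probability of an invariant set is a harmonic function of the initial
state, so the states where it is maximal are closed under all steps. -/
lemma chain_invariant_const [Nonempty S]
    (hR : ∀ A : Set S, A.Nonempty → (∀ s ∈ A, ∀ i, R.step s i ∈ A) → A = Set.univ)
    {E : Set (Sigma N)} (hE : MeasurableSet E) (hinv : shift ⁻¹' E = E) :
    ∃ c : ℝ, ∀ s, (R.chain s).real E = c := by
  obtain ⟨s₀, hs₀⟩ := Finite.exists_max fun s => (R.chain s).real E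
  have hharm : ∀ s, (R.chain s).real E = ∑ i, R.prob s i * (R.chain (R.step s i)).real E := by
    intro s
    have := R.chain_eq_sum s hE
    rw [hinv] at this
    rw [Measure.real, this, ENNReal.toReal_sum fun i _ =>
      ENNReal.mul_ne_top ENNReal.ofReal_ne_top (measure_ne_top _ _)]
    refine Finset.sum_congr rfl fun i _ => ?_
    rw [ENNReal.toReal_mul, ENNReal.toReal_ofReal (R.prob_pos s i).le, Measure.real]
  refine ⟨(R.chain s₀).real E, fun s => ?_⟩
  have huniv := hR {s | (R.chain s).real E = (R.chain s₀).real E} ⟨s₀, rfl⟩ ?_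
  · exact Set.eq_univ_iff_forall.1 huniv s
  intro s hs i
  have hs' : (R.chain s).real E = (R.chain s₀).real E := hs
  have hsum : ∑ j, R.prob s j * ((R.chain s₀).real E - (R.chain (R.step s j)).real E) = 0 := by
    simp only [mul_sub, Finset.sum_sub_distrib, ← Finset.sum_mul, R.sum_prob, one_mul]
    rw [← hharm s, hs', sub_self]
  have := (Finset.sum_eq_zero_iff_of_nonneg fun j _ =>
    mul_nonneg (R.prob_pos s j).le (sub_nonneg.2 (hs₀ (R.step s j)))).1 hsum i (Finset.mem_univ i)
  have := (mul_eq_zero.1 this).resolve_left (R.prob_pos s i).ne'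
  exact (sub_eq_zero.1 this).symm

/-- By the Markov property the tail after reading `w` is again a chain, for which `E` has
probability `c`. Thus `E` is independent of all cylinders, hence of itself, which yields $c=c^2$ in
the ergodicity proof. -/
lemma chain_inter_prefixWord {E : Set (Sigma N)} (hE : MeasurableSet E) (hinv : shift ⁻¹' E = E)
    {c : ENNReal} (hc : ∀ s, R.chain s E = c) (n : ℕ) (w : Fin n → Fin N) (s : S) :
    R.chain s (prefixWord n ⁻¹' {w} ∩ E) = c * R.chain s (prefixWord n ⁻¹' {w}) := by
  induction n generalizing s with
  | zero =>
    have : prefixWord 0 ⁻¹' {w} = (Set.univ : Set (Sigma N)) := by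
      ext x; simp [Subsingleton.elim (prefixWord 0 x) w]
    simp [this, hc]
  | succ n ih =>
    have hcyl : MeasurableSet (prefixWord n ⁻¹' {Fin.tail w} : Set (Sigma N)) :=
      measurable_prefixWord n (measurableSet_singleton _)
    have hset : prefixWord (n + 1) ⁻¹' {w} ∩ E = {x : Sigma N | x 0 = w 0} ∩
        shift ⁻¹' (prefixWord n ⁻¹' {Fin.tail w} ∩ E) := by
      rw [preimage_prefixWord_succ, Set.preimage_inter, hinv, Set.inter_assoc]
    rw [hset, R.chain_head_tail _ _ (hcyl.inter hE), ih, preimage_prefixWord_succ,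
      R.chain_head_tail _ _ hcyl]
    ring

/-- If the automaton is irreducible then its stationary measure is ergodic. -/
theorem ergodic_stationary [Nonempty S]
    (hR : ∀ A : Set S, A.Nonempty → (∀ s ∈ A, ∀ i, R.step s i ∈ A) → A = Set.univ) :
    Ergodic shift R.stationary := by
  refine ⟨R.measurePreserving_stationary, ⟨fun E hE hinv => ?_⟩⟩
  obtain ⟨c, hc⟩ := chain_invariant_const hR hE hinv
  have hc' : ∀ s, R.chain s E = ENNReal.ofReal c := fun s => by
    rw [← hc s, ofReal_measureReal]
  have hcc : c = c * c := by
    obtain ⟨s⟩ := ‹Nonempty S›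
    have hext : (R.chain s).restrict E = ENNReal.ofReal c • R.chain s := by
      refine ext_of_prefixWord fun n w => ?_
      rw [Measure.restrict_apply (measurable_prefixWord n (measurableSet_singleton _)),
        chain_inter_prefixWord hE hinv hc', Measure.smul_apply, smul_eq_mul]
    have h1 := congrArg (fun m : Measure (Sigma N) => (m E).toReal) hext
    simp only [Measure.restrict_apply_self, Measure.smul_apply, smul_eq_mul,
      ENNReal.toReal_mul] at h1
    rw [ENNReal.toReal_ofReal (by rw [← hc s]; exact measureReal_nonneg), ← Measure.real, hc] at h1
    exact h1
  rw [eventuallyConst_set']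
  rcases eq_or_ne c 0 with rfl | h0
  · left
    refine ae_eq_empty.2 ?_
    rw [stationary, mix_apply]
    simp [hc']
  · right
    have h1 : c = 1 := (mul_right_cancel₀ h0 ((one_mul c).trans hcc)).symm
    refine ae_eq_univ.2 ?_
    rw [stationary, mix_apply]
    refine Finset.sum_eq_zero fun s _ => ?_
    rw [(prob_compl_eq_zero_iff hE).2 (by rw [hc', h1, ENNReal.ofReal_one]), mul_zero]

/-- A potential comparable with the sum of the path weights has the stationary measure as a Gibbs
measure. -/
theorem exists_isGibbs_stationary [Nonempty S] {Φ : List (Fin N) → ℝ} (hΦ : ∀ w, 0 < Φ w) {D : ℝ}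
    (hlow : ∀ s w, R.pathWeight s w ≤ Φ w) (hupp : ∀ w, Φ w ≤ D * ∑ s, R.pathWeight s w) :
    ∃ K, IsGibbs Φ (Real.log R.eig) K R.stationary := by
  obtain ⟨a, ha⟩ := Finite.exists_min R.r
  obtain ⟨b, hb⟩ := Finite.exists_max R.r
  have hapos := R.r_pos a
  have hbpos := R.r_pos b
  have hZ := R.mass_pos
  have hcard : (0 : ℝ) < Fintype.card S := Nat.cast_pos.2 Fintype.card_pos
  have hsumpos : ∀ w, 0 < ∑ s, R.pathWeight s w := fun w =>
    Finset.sum_pos (fun s _ => R.pathWeight_pos s w) Finset.univ_nonempty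
  have hD : 0 < D := by
    have := (hΦ []).trans_le (hupp [])
    exact (pos_iff_pos_of_mul_pos this).2 (hsumpos [])
  -- The Gibbs measure of a cylinder differs from the normalized sum of path weights only through
  -- the factors `r`, which lie between `r a` and `r b`.
  have hμ : ∀ n (w : Fin n → Fin N), R.eig ^ n * R.stationary.real (prefixWord n ⁻¹' {w}) =
      R.mass⁻¹ * ∑ s, R.pathWeight s (List.ofFn w) *
        (R.r s * R.r (R.endState s (List.ofFn w))) := by
    intro n w
    rw [stationary, R.measureReal_mix fun _ => inv_nonneg.2 hZ.le, Finset.mul_sum, Finset.mul_sum]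
    refine Finset.sum_congr rfl fun s _ => ?_
    have h1 := (R.r_pos s).ne'
    have h2 := R.eig_pos.ne'
    rw [R.measureReal_chain_prefixWord]
    field_simp
  have hμlow : ∀ n (w : Fin n → Fin N), R.mass⁻¹ * R.r a ^ 2 * ∑ s, R.pathWeight s (List.ofFn w) ≤
      R.eig ^ n * R.stationary.real (prefixWord n ⁻¹' {w}) := by
    intro n w
    rw [hμ, mul_assoc, Finset.mul_sum]
    refine mul_le_mul_of_nonneg_left (Finset.sum_le_sum fun s _ => ?_) (inv_nonneg.2 hZ.le)
    rw [mul_comm, sq]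
    exact mul_le_mul_of_nonneg_left (mul_le_mul (ha _) (ha _) hapos.le (R.r_pos _).le)
      (R.pathWeight_pos _ _).le
  have hμupp : ∀ n (w : Fin n → Fin N), R.eig ^ n * R.stationary.real (prefixWord n ⁻¹' {w}) ≤
      R.mass⁻¹ * R.r b ^ 2 * ∑ s, R.pathWeight s (List.ofFn w) := by
    intro n w
    rw [hμ, mul_assoc, Finset.mul_sum _ _ (R.r b ^ 2)]
    refine mul_le_mul_of_nonneg_left (Finset.sum_le_sum fun s _ => ?_) (inv_nonneg.2 hZ.le)
    rw [mul_comm (R.r b ^ 2), sq]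
    exact mul_le_mul_of_nonneg_left (mul_le_mul (hb _) (hb _) (R.r_pos _).le hbpos.le)
      (R.pathWeight_pos _ _).le
  have hpos : ∀ n (w : Fin n → Fin N), 0 < R.stationary.real (prefixWord n ⁻¹' {w}) := by
    intro n w
    have h1 := (mul_pos (mul_pos (inv_pos.2 hZ) (pow_pos hapos 2))
      (hsumpos (List.ofFn w))).trans_le (hμlow n w)
    exact (pos_iff_pos_of_mul_pos h1).1 (pow_pos R.eig_pos n)
  set α := (R.mass⁻¹ * R.r b ^ 2 * Fintype.card S)⁻¹ with hα
  set β := D / (R.mass⁻¹ * R.r a ^ 2) with hβ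
  have hαpos : 0 < α := by positivity
  have hβpos : 0 < β := by positivity
  refine ⟨max (-Real.log α) (Real.log β), hpos, fun n w => ?_⟩
  set W := ∑ s, R.pathWeight s (List.ofFn w) with hW
  set m := R.eig ^ n * R.stationary.real (prefixWord n ⁻¹' {w}) with hm
  have hmpos : 0 < m := mul_pos (pow_pos R.eig_pos n) (hpos n w)
  have hWΦ : W ≤ Fintype.card S * Φ (List.ofFn w) := by
    rw [hW]
    refine (Finset.sum_le_sum fun s _ => hlow s (List.ofFn w)).trans_eq ?_
    simp
  have h1 : α * m ≤ Φ (List.ofFn w) := by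
    rw [hα, inv_mul_le_iff₀ (by positivity)]
    calc m ≤ R.mass⁻¹ * R.r b ^ 2 * W := hμupp n w
      _ ≤ R.mass⁻¹ * R.r b ^ 2 * (Fintype.card S * Φ (List.ofFn w)) := by gcongr
      _ = _ := by ring
  have h2 : Φ (List.ofFn w) ≤ β * m := by
    calc Φ (List.ofFn w) ≤ D * W := hupp _
      _ = β * (R.mass⁻¹ * R.r a ^ 2 * W) := by rw [hβ]; field_simp
      _ ≤ β * m := by gcongr; exact hμlow n w
  have hlogm : Real.log m = n * Real.log R.eig +
      Real.log (R.stationary.real (prefixWord n ⁻¹' {w})) := by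
    rw [hm, Real.log_mul (pow_pos R.eig_pos n).ne' (hpos n w).ne', Real.log_pow]
  have h1' := Real.log_le_log (mul_pos hαpos hmpos) h1
  have h2' := Real.log_le_log (hΦ _) h2
  rw [Real.log_mul hαpos.ne' hmpos.ne', hlogm] at h1'
  rw [Real.log_mul hβpos.ne' hmpos.ne', hlogm] at h2'
  rw [abs_le]
  constructor
  · linarith [le_max_left (-Real.log α) (Real.log β)]
  · linarith [le_max_right (-Real.log α) (Real.log β)]

/-- If the states split into two classes that are exchanged by all symbols, with indicator functions
`ρ` and `ρ'`, and the stationary measure is ergodic for the second iterate of the shift, then the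
two classes carry the same measure. -/
lemma mix_eq_mix_of_ergodic_iterate_two {ρ ρ' : S → ℝ} (hρ : ∀ s, 0 ≤ ρ s) (hρ' : ∀ s, 0 ≤ ρ' s)
    (h : ∀ s i, ρ (R.step s i) = ρ' s) (h' : ∀ s i, ρ' (R.step s i) = ρ s)
    (hsum : ∀ s, ρ s + ρ' s = R.mass⁻¹) (herg : Ergodic (shift^[2]) R.stationary) :
    R.mix ρ = R.mix ρ' := by
  have h1 := R.map_shift_mix hρ h
  have h2 := R.map_shift_mix hρ' h'
  have hstat : R.stationary = R.mix ρ + R.mix ρ' := by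
    rw [← R.mix_add hρ hρ', stationary]
    congr 1
    ext s
    exact (hsum s).symm
  have hmp : MeasurePreserving shift^[2] (R.mix ρ) (R.mix ρ) := by
    refine ⟨measurable_shift.iterate 2, ?_⟩
    rw [show shift^[2] = shift ∘ shift (N := N) from rfl,
      ← Measure.map_map measurable_shift measurable_shift, h1, h2]
  have : IsFiniteMeasure R.stationary := inferInstanceAs (IsFiniteMeasure (R.mix _))
  -- Ergodicity of the second iterate makes `mix ρ` a multiple of the stationary measure. It is then
  -- invariant under the shift itself, which maps it to `mix ρ'`.
  obtain ⟨c, hc⟩ := herg.eq_smul_of_absolutelyContinuous hmp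
    (hstat ▸ (Measure.AbsolutelyContinuous.rfl.add_right _))
  calc R.mix ρ = c • R.stationary := hc
    _ = (c • R.stationary).map shift := by
        rw [Measure.map_smul, R.measurePreserving_stationary.map_eq]
    _ = R.mix ρ' := by rw [← hc, h1]

end Ergodic

end ReversibleSystem

/-! ### Norms of products of nonnegative monomial matrices. -/

/-- Product of the entries met along a word of monomial matrices, from the row `e`. -/
def monomialWeight (c : Fin 2 → Fin 2 → ℝ) (σ : Fin 2 → Fin 2 → Fin 2) :
    Fin 2 → List (Fin 2) → ℝ
  | _, [] => 1
  | e, i :: w => c e i * monomialWeight c σ (σ e i) w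

/-- The column of the nonzero entry of the row `e` in a product of monomial matrices. -/
def monomialColumn (σ : Fin 2 → Fin 2 → Fin 2) : Fin 2 → List (Fin 2) → Fin 2
  | e, [] => e
  | e, i :: w => monomialColumn σ (σ e i) w

lemma monomialWeight_nonneg {c : Fin 2 → Fin 2 → ℝ} (hc : ∀ e i, 0 ≤ c e i)
    (σ : Fin 2 → Fin 2 → Fin 2) (e : Fin 2) (w : List (Fin 2)) : 0 ≤ monomialWeight c σ e w := by
  induction w generalizing e with
  | nil => exact zero_le_one
  | cons i w ih => exact mul_nonneg (hc e i) (ih _)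

section Monomial

variable {A : Fin 2 → EuclideanSpace ℝ (Fin 2) →L[ℝ] EuclideanSpace ℝ (Fin 2)}
  {c : Fin 2 → Fin 2 → ℝ} {σ : Fin 2 → Fin 2 → Fin 2}

lemma wordProd_apply_of_monomial (hA : ∀ i x e, A i x e = c e i * x (σ e i)) (w : List (Fin 2))
    (x : EuclideanSpace ℝ (Fin 2)) (e : Fin 2) :
    wordProd A w x e = monomialWeight c σ e w * x (monomialColumn σ e w) := by
  induction w generalizing e with
  | nil => simp [wordProd, monomialWeight, monomialColumn]
  | cons i w ih =>
    rw [wordProd_cons, mul_apply_eq_comp, hA, ih, monomialWeight, monomialColumn,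
      mul_assoc]

lemma monomialWeight_le_norm (hA : ∀ i x e, A i x e = c e i * x (σ e i)) (w : List (Fin 2))
    (e : Fin 2) : monomialWeight c σ e w ≤ ‖wordProd A w‖ := by
  -- The basis vector of the column where row `e` has its nonzero entry picks out that entry.
  set x : EuclideanSpace ℝ (Fin 2) := EuclideanSpace.single (monomialColumn σ e w) 1 with hx
  have h1 : wordProd A w x e = monomialWeight c σ e w := by
    rw [wordProd_apply_of_monomial hA]; simp [hx]
  calc monomialWeight c σ e w ≤ ‖wordProd A w x e‖ := by rw [h1]; exact le_abs_self _
    _ ≤ ‖wordProd A w x‖ := PiLp.norm_apply_le _ e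
    _ ≤ ‖wordProd A w‖ * ‖x‖ := ContinuousLinearMap.le_opNorm _ _
    _ = ‖wordProd A w‖ := by simp [hx]

lemma norm_le_monomialWeight_add (hA : ∀ i x e, A i x e = c e i * x (σ e i))
    (hc : ∀ e i, 0 ≤ c e i) (w : List (Fin 2)) :
    ‖wordProd A w‖ ≤ monomialWeight c σ 0 w + monomialWeight c σ 1 w := by
  have hw := fun e => monomialWeight_nonneg hc σ e w
  refine ContinuousLinearMap.opNorm_le_bound _ (add_nonneg (hw 0) (hw 1)) fun x => ?_
  have hbound : ∀ e, ‖wordProd A w x e‖ ≤ monomialWeight c σ e w * ‖x‖ := fun e => by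
    rw [wordProd_apply_of_monomial hA, norm_mul, Real.norm_of_nonneg (hw e)]
    exact mul_le_mul_of_nonneg_left (PiLp.norm_apply_le _ _) (hw e)
  calc ‖wordProd A w x‖ ≤ ‖wordProd A w x 0‖ + ‖wordProd A w x 1‖ := by
        rw [EuclideanSpace.norm_eq, Fin.sum_univ_two]
        refine Real.sqrt_le_iff.2 ⟨by positivity, ?_⟩
        nlinarith [norm_nonneg (wordProd A w x 0), norm_nonneg (wordProd A w x 1)]
    _ ≤ _ := by rw [add_mul]; exact add_le_add (hbound 0) (hbound 1)

lemma norm_rpow_le (hA : ∀ i x e, A i x e = c e i * x (σ e i))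
    (hc : ∀ e i, 0 ≤ c e i) (w : List (Fin 2)) {β : ℝ} (hβ : 0 ≤ β) :
    ‖wordProd A w‖ ^ β ≤ 2 ^ β * ∑ e, monomialWeight c σ e w ^ β := by
  have hw := fun e => monomialWeight_nonneg hc σ e w
  obtain ⟨e, he⟩ := Finite.exists_max fun e => monomialWeight c σ e w
  calc ‖wordProd A w‖ ^ β ≤ (2 * monomialWeight c σ e w) ^ β := by
        refine Real.rpow_le_rpow (norm_nonneg _) ?_ hβ
        linarith [norm_le_monomialWeight_add hA hc w, he 0, he 1]
    _ = 2 ^ β * monomialWeight c σ e w ^ β := Real.mul_rpow (by norm_num) (hw e)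
    _ ≤ _ := by
        gcongr
        exact Finset.single_le_sum (f := fun e => monomialWeight c σ e w ^ β)
          (fun e _ => Real.rpow_nonneg (hw e) β) (Finset.mem_univ e)

end Monomial

/-! ### The four-state automaton of the two pairs. -/

/-- The transfer matrix is bipartite, with block $C=\begin{pmatrix}p&1\\q&1\end{pmatrix}$ from odd
to even states and $C^T$ back. The vector $(u,v)$ is the Perron eigenvector of $CC^T$ with
eigenvalue $L$, $l=\sqrt L$, and $(x,y)=C^T(u,v)/l$. -/
lemma exists_symmetric_eigenvector {p q : ℝ} (hp : 0 < p) (hq : 0 < q) :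
    ∃ l u v x y : ℝ, 0 < l ∧ 0 < u ∧ 0 < v ∧ 0 < x ∧ 0 < y ∧ p * x + y = l * u ∧
      y + q * x = l * v ∧ p * u + q * v = l * x ∧ u + v = l * y := by
  -- The discriminant of the characteristic polynomial of
  -- $CC^T=\begin{pmatrix}p^2+1&pq+1\\pq+1&q^2+1\end{pmatrix}$.
  set s := Real.sqrt ((p ^ 2 - q ^ 2) ^ 2 + 4 * (p * q + 1) ^ 2) with hs
  have hs2 : s ^ 2 = (p ^ 2 - q ^ 2) ^ 2 + 4 * (p * q + 1) ^ 2 := Real.sq_sqrt (by positivity)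
  have hlt : p ^ 2 - q ^ 2 < s := Real.lt_sqrt_of_sq_lt (by nlinarith [mul_pos hp hq])
  have hs0 : 0 ≤ s := Real.sqrt_nonneg _
  set L := (p ^ 2 + q ^ 2 + 2 + s) / 2 with hL
  have hL0 : 0 < L := by positivity
  set v := L - (p ^ 2 + 1) with hv
  have hv0 : 0 < v := by rw [hv, hL]; linarith
  have hu0 : 0 < p * q + 1 := by positivity
  have hl0 : 0 < Real.sqrt L := Real.sqrt_pos.2 hL0
  have hl2 : Real.sqrt L * Real.sqrt L = L := Real.mul_self_sqrt hL0.le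
  have hchar : (p * q + 1) ^ 2 + (q ^ 2 + 1) * v = L * v := by
    rw [hv, hL]; linear_combination (-1 / 4) * hs2
  refine ⟨Real.sqrt L, p * q + 1, v, (p * (p * q + 1) + q * v) / Real.sqrt L,
    (p * q + 1 + v) / Real.sqrt L, hl0, hu0, hv0, by positivity, by positivity, ?_, ?_, ?_, ?_⟩
  · field_simp
    rw [sq, hl2, hv]; ring
  · field_simp
    rw [sq, hl2]; linear_combination hchar
  · field_simp
  · field_simp

/-- The pair of rows of `A` and `B` reached by reading a symbol. -/
def pairStep (s : Fin 2 × Fin 2) (i : Fin 2) : Fin 2 × Fin 2 :=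
  (![s.1, s.1 + 1] i, ![s.2 + 1, s.2] i)

/-- The weights of the transitions, `p` and `q` standing for `2 ^ β₁` and `2 ^ β₂`. -/
def pairWeight (p q : ℝ) (s : Fin 2 × Fin 2) (i : Fin 2) : ℝ := ![![p, 1] s.1, ![1, q] s.2] i

lemma exists_reversibleSystem {p q : ℝ} (hp : 0 < p) (hq : 0 < q) :
    ∃ R : ReversibleSystem (Fin 2 × Fin 2) 2, R.step = pairStep ∧ R.wt = pairWeight p q := by
  obtain ⟨l, u, v, x, y, hl, hu, hv, hx, hy, h1, h2, h3, h4⟩ := exists_symmetric_eigenvector hp hq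
  -- The even states $(0,0),(1,1)$ receive $u,v$ and the odd states $(0,1),(1,0)$ receive $x,y$.
  refine ⟨⟨pairStep, pairWeight p q, fun s => !![u, x; y, v] s.1 s.2, l, ?_, ?_, hl, ?_, ?_, ?_⟩,
    rfl, rfl⟩
  · rintro ⟨e, f⟩ i
    fin_cases e <;> fin_cases f <;> fin_cases i <;> simp [pairWeight, hp, hq]
  · rintro ⟨e, f⟩
    fin_cases e <;> fin_cases f <;> simp [hu, hv, hx, hy]
  · decide
  · rintro ⟨e, f⟩ i
    fin_cases i <;> simp [pairWeight, pairStep]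
  · rintro ⟨e, f⟩
    fin_cases e <;> fin_cases f <;> simp [pairWeight, pairStep, Fin.sum_univ_two] <;> linarith

lemma pairStep_irreducible (A : Set (Fin 2 × Fin 2)) (hA : A.Nonempty)
    (h : ∀ s ∈ A, ∀ i, pairStep s i ∈ A) : A = Set.univ := by
  obtain ⟨s, hs⟩ := hA
  have h0 := h _ hs 0
  have h1 := h _ hs 1
  have h01 := h _ h0 1
  refine Set.eq_univ_of_forall fun t => ?_
  have key : ∀ s t : Fin 2 × Fin 2,
      t = s ∨ t = pairStep s 0 ∨ t = pairStep s 1 ∨ t = pairStep (pairStep s 0) 1 := by decide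
  rcases key s t with rfl | rfl | rfl | rfl <;> assumption

/-! ### Comparison of the potential with path weights, and failure of ergodicity for the second
iterate. -/

section Pair

variable {β₁ β₂ : ℝ} {R : ReversibleSystem (Fin 2 × Fin 2) 2}

lemma pairA_monomial (i : Fin 2) (x : EuclideanSpace ℝ (Fin 2)) (e : Fin 2) :
    pairA i x e = ![![2, 1] e, 1] i * x (![e, e + 1] i) := by
  fin_cases i <;> fin_cases e <;> simp [pairA, planeMap_apply]

lemma pairB_monomial (i : Fin 2) (x : EuclideanSpace ℝ (Fin 2)) (f : Fin 2) :
    pairB i x f = ![1, ![1, 2] f] i * x (![f + 1, f] i) := by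
  fin_cases i <;> fin_cases f <;> simp [pairB, planeMap_apply]

/-- The weights of the rows of the products along words of the first pair. -/
abbrev rowWeightA : Fin 2 → List (Fin 2) → ℝ :=
  monomialWeight (fun e i => ![![2, 1] e, 1] i) (fun e i => ![e, e + 1] i)

/-- The weights of the rows of the products along words of the second pair. -/
abbrev rowWeightB : Fin 2 → List (Fin 2) → ℝ :=
  monomialWeight (fun f i => ![1, ![1, 2] f] i) (fun f i => ![f + 1, f] i)

lemma entryA_nonneg (e i : Fin 2) : (0 : ℝ) ≤ ![![2, 1] e, 1] i := by
  fin_cases e <;> fin_cases i <;> simp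

lemma entryB_nonneg (f i : Fin 2) : (0 : ℝ) ≤ ![1, ![1, 2] f] i := by
  fin_cases f <;> fin_cases i <;> simp

lemma pathWeight_eq (hs : R.step = pairStep) (hw : R.wt = pairWeight (2 ^ β₁) (2 ^ β₂))
    (s : Fin 2 × Fin 2) (w : List (Fin 2)) :
    R.pathWeight s w = rowWeightA s.1 w ^ β₁ * rowWeightB s.2 w ^ β₂ := by
  induction w generalizing s with
  | nil => simp [ReversibleSystem.pathWeight, monomialWeight]
  | cons i w ih =>
    rw [ReversibleSystem.pathWeight, ih, rowWeightA, rowWeightB, monomialWeight, monomialWeight,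
      Real.mul_rpow (entryA_nonneg _ _) (monomialWeight_nonneg entryA_nonneg _ _ _),
      Real.mul_rpow (entryB_nonneg _ _) (monomialWeight_nonneg entryB_nonneg _ _ _), hs, hw]
    have : pairWeight (2 ^ β₁) (2 ^ β₂) s i =
        (![![2, 1] s.1, 1] i : ℝ) ^ β₁ * (![1, ![1, 2] s.2] i : ℝ) ^ β₂ := by
      obtain ⟨e, f⟩ := s
      fin_cases i <;> fin_cases e <;> fin_cases f <;> simp [pairWeight]
    rw [this]
    simp only [pairStep]
    ring

lemma pathWeight_le_pairPotential (hs : R.step = pairStep)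
    (hw : R.wt = pairWeight (2 ^ β₁) (2 ^ β₂)) (hβ₁ : 0 ≤ β₁) (hβ₂ : 0 ≤ β₂)
    (s : Fin 2 × Fin 2) (w : List (Fin 2)) : R.pathWeight s w ≤ pairPotential β₁ β₂ w := by
  rw [pathWeight_eq hs hw, pairPotential]
  have hA := monomialWeight_nonneg entryA_nonneg (fun e i => ![e, e + 1] i) s.1 w
  have hB := monomialWeight_nonneg entryB_nonneg (fun f i => ![f + 1, f] i) s.2 w
  exact mul_le_mul (Real.rpow_le_rpow hA (monomialWeight_le_norm pairA_monomial w s.1) hβ₁)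
    (Real.rpow_le_rpow hB (monomialWeight_le_norm pairB_monomial w s.2) hβ₂)
    (Real.rpow_nonneg hB _) (Real.rpow_nonneg (norm_nonneg _) _)

lemma pairPotential_le_sum_pathWeight (hs : R.step = pairStep)
    (hw : R.wt = pairWeight (2 ^ β₁) (2 ^ β₂)) (hβ₁ : 0 ≤ β₁) (hβ₂ : 0 ≤ β₂) (w : List (Fin 2)) :
    pairPotential β₁ β₂ w ≤ (2 ^ β₁ * 2 ^ β₂) * ∑ s, R.pathWeight s w := by
  have hA := norm_rpow_le pairA_monomial entryA_nonneg w hβ₁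
  have hB := norm_rpow_le pairB_monomial entryB_nonneg w hβ₂
  calc pairPotential β₁ β₂ w
      ≤ (2 ^ β₁ * ∑ e, rowWeightA e w ^ β₁) * (2 ^ β₂ * ∑ f, rowWeightB f w ^ β₂) :=
        mul_le_mul hA hB (Real.rpow_nonneg (norm_nonneg _) _)
          ((Real.rpow_nonneg (norm_nonneg _) _).trans hA)
    _ = _ := by
        simp only [pathWeight_eq hs hw, Fintype.sum_prod_type, Fin.sum_univ_two]
        ring

/-- Indicator of the pairs of rows of a given parity. -/
def parityIndicator (t : Fin 2) (s : Fin 2 × Fin 2) : ℝ := if s.1 + s.2 = t then 1 else 0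

/-- Were the second iterate ergodic, the even and odd halves of the stationary measure would agree
on every cylinder. Words of length two with equal letters already force `r` to be constant,
contradicting the eigenvector equations. -/
lemma not_ergodic_iterate_two (hs : R.step = pairStep) {p q : ℝ} (hp : 1 < p) (hq : 1 < q)
    (hw : R.wt = pairWeight p q) : ¬ Ergodic (shift^[2]) R.stationary := by
  intro herg
  have hZ := R.mass_pos
  have hnonneg : ∀ t s, 0 ≤ R.mass⁻¹ * parityIndicator t s := fun t s =>
    mul_nonneg (inv_nonneg.2 hZ.le) (by unfold parityIndicator; split_ifs <;> norm_num)
  have hpar : ∀ t s i, parityIndicator t (pairStep s i) = parityIndicator (t + 1) s := by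
    have : ∀ (t : Fin 2) (s : Fin 2 × Fin 2) (i : Fin 2),
        (pairStep s i).1 + (pairStep s i).2 = t ↔ s.1 + s.2 = t + 1 := by decide
    intro t s i
    simp only [parityIndicator, this]
  have heq := ReversibleSystem.mix_eq_mix_of_ergodic_iterate_two
    (ρ := fun s => R.mass⁻¹ * parityIndicator 0 s) (ρ' := fun s => R.mass⁻¹ * parityIndicator 1 s)
    (hnonneg 0) (hnonneg 1) (fun s i => by rw [hs, hpar]; rfl) (fun s i => by rw [hs, hpar]; rfl)
    (fun s => by
      have : ∀ s, parityIndicator 0 s + parityIndicator 1 s = 1 := by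
        rintro ⟨e, f⟩
        fin_cases e <;> fin_cases f <;> simp [parityIndicator]
      rw [← mul_add, this, mul_one]) herg
  have hword : ∀ i : Fin 2, ∑ s, parityIndicator 0 s * R.r s ^ 2 * pairWeight p q s i ^ 2 =
      ∑ s, parityIndicator 1 s * R.r s ^ 2 * pairWeight p q s i ^ 2 := by
    intro i
    -- Reading the same symbol twice returns to the initial state, so the factors `r` cancel.
    have hcyl : ∀ s, (R.chain s).real (prefixWord 2 ⁻¹' {fun _ => i}) =
        pairWeight p q s i ^ 2 * (R.eig ^ 2)⁻¹ := by
      intro s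
      rw [R.measureReal_chain_prefixWord]
      simp only [List.ofFn_succ, List.ofFn_zero, ReversibleSystem.pathWeight,
        ReversibleSystem.endState, R.step_step, R.wt_step, mul_one, hw]
      have := (R.r_pos s).ne'
      field_simp
    have h := congrArg (fun m : Measure (Sigma 2) => m.real (prefixWord 2 ⁻¹' {fun _ => i})) heq
    simp only [R.measureReal_mix (hnonneg 0), R.measureReal_mix (hnonneg 1), hcyl] at h
    have hne : R.mass⁻¹ * (R.eig ^ 2)⁻¹ ≠ 0 :=
      mul_ne_zero (inv_ne_zero hZ.ne') (inv_ne_zero (pow_ne_zero _ R.eig_pos.ne'))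
    refine mul_left_cancel₀ hne ?_
    rw [Finset.mul_sum, Finset.mul_sum]
    convert h using 2 <;> ring
  have hmass : ∑ s, parityIndicator 0 s * R.r s ^ 2 = ∑ s, parityIndicator 1 s * R.r s ^ 2 := by
    have h := congrArg (fun m : Measure (Sigma 2) => m.real Set.univ) heq
    simp only [R.measureReal_mix (hnonneg 0), R.measureReal_mix (hnonneg 1), probReal_univ,
      mul_one] at h
    refine mul_left_cancel₀ (inv_ne_zero hZ.ne') ?_
    rw [Finset.mul_sum, Finset.mul_sum]
    simpa only [mul_assoc] using h
  have h0 := hword 0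
  have h1 := hword 1
  simp [Fintype.sum_prod_type, Fin.sum_univ_two, parityIndicator, pairWeight] at h0 h1 hmass
  have e00 := R.sum_wt_mul (0, 0)
  have e01 := R.sum_wt_mul (0, 1)
  have e11 := R.sum_wt_mul (1, 1)
  rw [hs, hw] at e00 e01 e11
  simp [pairWeight, pairStep, Fin.sum_univ_two] at e00 e01 e11
  have p00 := R.r_pos (0, 0)
  have p01 := R.r_pos (0, 1)
  have p10 := R.r_pos (1, 0)
  have p11 := R.r_pos (1, 1)
  -- Subtracting the equality of total masses removes the states where the symbol has weight 1,
  -- leaving one even and one odd state.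
  have a1 : R.r (0, 0) = R.r (0, 1) := by
    have : (p ^ 2 - 1) * (R.r (0, 0) ^ 2 - R.r (0, 1) ^ 2) = 0 := by linear_combination h0 - hmass
    have := (mul_eq_zero.1 this).resolve_left (by nlinarith)
    exact (pow_left_inj₀ p00.le p01.le two_ne_zero).1 (sub_eq_zero.1 this)
  have a2 : R.r (1, 1) = R.r (0, 1) := by
    have : (q ^ 2 - 1) * (R.r (1, 1) ^ 2 - R.r (0, 1) ^ 2) = 0 := by linear_combination h1 - hmass
    have := (mul_eq_zero.1 this).resolve_left (by nlinarith)
    exact (pow_left_inj₀ p11.le p01.le two_ne_zero).1 (sub_eq_zero.1 this)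
  have a3 : R.r (1, 0) = R.r (0, 1) := by
    rw [a1, a2] at hmass
    exact (pow_left_inj₀ p10.le p01.le two_ne_zero).1 (by linarith)
  rw [a1, a3] at e00
  rw [a1, a2] at e01
  -- For constant `r` the equations at $(0,0)$ and $(0,1)$ give the eigenvalue as $p+1$ and as
  -- $p+q$.
  have : (q - 1) * R.r (0, 1) = 0 := by linear_combination e01 - e00
  rcases mul_eq_zero.1 this with h | h <;> linarith

end Pair

end Thermo
end

theorem proposition4 (β₁ β₂ : ℝ) (hβ₁ : 0 < β₁) (hβ₂ : 0 < β₂) :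
    -- both pairs consist of invertible maps, are irreducible, and have no cyclic splitting
    (∀ i, IsUnit (Thermo.pairA i)) ∧ (∀ i, IsUnit (Thermo.pairB i)) ∧
    Thermo.Irreducible Thermo.pairA ∧ Thermo.Irreducible Thermo.pairB ∧
    ¬ Thermo.HasCyclicSplitting Thermo.pairA ∧ ¬ Thermo.HasCyclicSplitting Thermo.pairB ∧
    -- the potential is positive and submultiplicative
    Thermo.IsSubmultiplicativePotential (Thermo.pairPotential β₁ β₂) ∧
    -- there is exactly one equilibrium state, and it is not totally ergodic
    (∃! μ : MeasureTheory.Measure (Thermo.Sigma 2),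
      Thermo.IsEquilibriumState (Thermo.pairPotential β₁ β₂) μ) ∧
    ∀ μ : MeasureTheory.Measure (Thermo.Sigma 2),
      Thermo.IsEquilibriumState (Thermo.pairPotential β₁ β₂) μ →
        ¬ Thermo.TotallyErgodic Thermo.shift μ := by
  have hΦ := Thermo.isSubmultiplicativePotential_pairPotential hβ₁.le hβ₂.le
  have hp : (1 : ℝ) < 2 ^ β₁ := Real.one_lt_rpow one_lt_two hβ₁
  have hq : (1 : ℝ) < 2 ^ β₂ := Real.one_lt_rpow one_lt_two hβ₂
  obtain ⟨R, hs, hw⟩ := Thermo.exists_reversibleSystem (zero_lt_one.trans hp) (zero_lt_one.trans hq)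
  obtain ⟨K, hG⟩ := R.exists_isGibbs_stationary hΦ.1
    (Thermo.pathWeight_le_pairPotential hs hw hβ₁.le hβ₂.le)
    (Thermo.pairPotential_le_sum_pathWeight hs hw hβ₁.le hβ₂.le)
  have herg : Ergodic Thermo.shift R.stationary :=
    R.ergodic_stationary fun A hA h => Thermo.pairStep_irreducible A hA (hs ▸ h)
  refine ⟨Thermo.isUnit_pairA, Thermo.isUnit_pairB, Thermo.irreducible_pairA,
    Thermo.irreducible_pairB, Thermo.not_hasCyclicSplitting_pairA,
    Thermo.not_hasCyclicSplitting_pairB, hΦ,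
    ⟨R.stationary, (hG.isEquilibriumState_iff hΦ herg).2 rfl,
      fun ν hν => (hG.isEquilibriumState_iff hΦ herg).1 hν⟩, fun μ hμ htot => ?_⟩
  rw [(hG.isEquilibriumState_iff hΦ herg).1 hμ] at htot
  exact Thermo.not_ergodic_iterate_two hs hp hq hw (htot 2 one_le_two)
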